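/- Let $n$ and $D$ be even with $0\le D<n$, and let $p\in[0,1]$. Consider $n$ qubits on a ring (labels modulo $n$). A layer $\mathcal U^{(t)}(\rho)=U_t\rho U_t^\dagger$, $t=1,\dots,D/2$, is a brick-wall layer: $U_t$ is a tensor product of $n/2$ two-qubit unitaries on disjoint nearest-neighbour pairs, which alternate with $t$ between the even pairs $\{2k,2k+1\}$ and the odd pairs $\{2k+1,2k+2\}$. Let $\mathcal N$ be the tensor product over all qubits of the depolarizing channel $X\mapsto(1-p)X+p\,\mathrm{tr}(X)I/2$. The depth-$D$ noisy circuit is $\Phi=T_D\circ\dots\circ T_1$ with $$T_t=\mathcal N\circ\mathcal U^{(t)}\quad(t\le D/2),\qquad T_t=\mathcal N\circ\bigl[\mathcal U^{(D+1-t)}\bigr]^\dagger\quad(t>D/2),$$ and $\Phi^{\mathrm{1D}}_{\mathrm{avg}}$ is the average of $\Phi$ over all two-qubit gates $U$ drawn independently from the Haar measure on $U(4)$. Put $\tau_0=\mathrm{id}$ and $\tau_1(X)=\mathrm{tr}(X)I/2$. Then there is a unique probability distribution $P$ on $\{0,1\}^n$ with $$\Phi^{\mathrm{1D}}_{\mathrm{avg}}=\sum_{j\in\{0,1\}^n}P(j)\,\tau_{j_1}\otimes\dots\otimes\tau_{j_n},$$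 so that the expected number of depolarized qubits $\langle q\rangle=\sum_jP(j)\,|j|$, where $|j|$ is the number of ones of $j$, is well defined. Moreover, for every constant $c\in(0,3/4)$ there is a constant $\kappa>0$, depending only on $c$, such that for all $n$, $D$ and $p$ as above $$\frac{\langle q\rangle}{n}\;\ge\;c\left(1-(1-p)^{\kappa D^2}\right).$$ -/

import Mathlib

open MeasureTheory

noncomputable section

namespace NoisyCircuit

/-! ### Haar-random two-qubit gates -/

/-- Two-qubit unitaries; the computational basis is indexed by `Fin 2 × Fin 2`. -/
abbrev Gate : Type := Matrix.unitaryGroup (Fin 2 × Fin 2) ℂ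

instance : MeasurableSpace Gate := borel Gate

instance : BorelSpace Gate := ⟨rfl⟩

instance : CompactSpace Gate := by
  refine isCompact_iff_compactSpace.mp ?_
  have hbox : IsCompact (Set.pi Set.univ fun _ : Fin 2 × Fin 2 =>
      Set.pi Set.univ fun _ : Fin 2 × Fin 2 => Metric.closedBall (0 : ℂ) 1) :=
    isCompact_univ_pi fun _ => isCompact_univ_pi fun _ => isCompact_closedBall _ _
  refine hbox.of_isClosed_subset ?_ ?_
  · exact isClosed_unitary (R := Matrix (Fin 2 × Fin 2) (Fin 2 × Fin 2) ℂ)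
  · intro U hU i _ j _
    rw [mem_closedBall_zero_iff]
    exact entry_norm_bound_of_unitary hU i j

/-- The Haar probability measure on the two-qubit unitaries. -/
def haarGate : Measure Gate := Measure.haarMeasure ⊤

instance : IsProbabilityMeasure haarGate := by
  refine ⟨?_⟩
  have h := Measure.haarMeasure_self (G := Gate) (K₀ := ⊤)
  simpa [haarGate] using h

/-! ### Operators and maps on `n` qubits placed on a ring -/

/-- Operators on a single qubit. -/
abbrev QubitOp : Type := Matrix (Fin 2) (Fin 2) ℂ

/-- Operators on `n` qubits, labelled by `ZMod n` (periodic boundary conditions). -/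
abbrev Op (n : ℕ) : Type := Matrix (ZMod n → Fin 2) (ZMod n → Fin 2) ℂ

/-- The tensor product `⨂ᵢ E i` of single-qubit maps: the linear map sending
`⨂ᵢ |x' i⟩⟨y' i|` to `⨂ᵢ E i (|x' i⟩⟨y' i|)`. -/
def tensorMap {n : ℕ} [NeZero n] (E : ZMod n → Module.End ℂ QubitOp) :
    Module.End ℂ (Op n) where
  toFun ρ := Matrix.of fun x y => ∑ x' : ZMod n → Fin 2, ∑ y' : ZMod n → Fin 2,
    (∏ i, E i (Matrix.single (x' i) (y' i) 1) (x i) (y i)) * ρ x' y'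
  map_add' ρ σ := by
    ext x y
    simp [mul_add, Finset.sum_add_distrib]
  map_smul' a ρ := by
    ext x y
    simp [Finset.mul_sum, mul_left_comm]

/-- `τ₀` is the identity and `τ₁(X) = tr(X) I/2` replaces the qubit by the maximally
mixed state. -/
def tau (j : Fin 2) : Module.End ℂ QubitOp :=
  if j = 0 then LinearMap.id
  else (Matrix.traceLinearMap (Fin 2) ℂ ℂ).smulRight ((1 / 2 : ℂ) • (1 : QubitOp))

/-- The single-qubit depolarizing channel `X ↦ (1 - p) X + p tr(X) I/2`. -/
def depolarizing (p : ℝ) : Module.End ℂ QubitOp :=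
  ((1 - p : ℝ) : ℂ) • tau 0 + (p : ℂ) • tau 1

/-- A layer of noise: the depolarizing channel on every qubit. -/
def noise (n : ℕ) [NeZero n] (p : ℝ) : Module.End ℂ (Op n) :=
  tensorMap fun _ => depolarizing p

/-- The map `ρ ↦ U ρ U†`. -/
def conjBy {n : ℕ} [NeZero n] (U : Op n) : Module.End ℂ (Op n) where
  toFun ρ := U * ρ * U.conjTranspose
  map_add' ρ σ := by rw [mul_add, add_mul]
  map_smul' a ρ := by simp

/-! ### The one-dimensional architecture -/

/-- The `t`-th brick-wall layer (`n` even): the tensor product of the two-qubit gates `V k`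
acting on the neighbouring qubits `2k + t` and `2k + t + 1` modulo `n`, for `0 ≤ k < n / 2`.
Even and odd bonds of the ring alternate with the parity of `t`. -/
def brickLayer {n : ℕ} [NeZero n] (t : ℕ) (V : Fin (n / 2) → Gate) : Op n :=
  Matrix.of fun x y => ∏ k : Fin (n / 2),
    (V k : Matrix (Fin 2 × Fin 2) (Fin 2 × Fin 2) ℂ)
      (x ((2 * (k : ℕ) + t : ℕ) : ZMod n), x ((2 * (k : ℕ) + t + 1 : ℕ) : ZMod n))
      (y ((2 * (k : ℕ) + t : ℕ) : ZMod n), y ((2 * (k : ℕ) + t + 1 : ℕ) : ZMod n))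

/-- The `t`-th noisy layer (`0 ≤ t < 2h`) of the circuit: the first `h` layers apply the unitary
layers `0, …, h - 1`; the last `h` layers undo them in the order `h - 1, …, 0`. Every layer is
followed by noise. -/
def noisyLayer {n : ℕ} [NeZero n] (p : ℝ) {h : ℕ} (V : Fin h → Fin (n / 2) → Gate)
    (t : Fin (2 * h)) : Module.End ℂ (Op n) :=
  noise n p ∘ₗ
    if ht : (t : ℕ) < h then
      conjBy (brickLayer (t : ℕ) (V ⟨t, ht⟩))
    else
      conjBy (brickLayer (2 * h - 1 - (t : ℕ)) (V ⟨2 * h - 1 - (t : ℕ), by omega⟩)).conjTranspose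

/-- The noisy circuit of depth `2h` for a fixed choice of gates: layer `0` is applied first. -/
def noisyCircuit {n : ℕ} [NeZero n] (p : ℝ) {h : ℕ} (V : Fin h → Fin (n / 2) → Gate) :
    Module.End ℂ (Op n) :=
  (List.ofFn (noisyLayer p V)).reverse.prod

/-- The channel of depth `D` (`D` even) averaged over independent Haar-random gates; the integral
of the operator-valued function is taken entry by entry. -/
def averagedChannel (n : ℕ) [NeZero n] (D : ℕ) (p : ℝ) (ρ : Op n) : Op n :=
  Matrix.of fun x y => ∫ V : Fin (D / 2) → Fin (n / 2) → Gate,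
    noisyCircuit p V ρ x y ∂(Measure.pi fun _ => Measure.pi fun _ => haarGate)

/-! ### Depolarized qubits -/

/-- `P` is the joint law of the depolarized qubits for the map `Φ`: it is a probability
distribution on `{0, 1}ⁿ` and `Φ = ∑ⱼ P(j) ⨂ᵢ τ_{jᵢ}`. -/
structure IsDepolarizationLaw {n : ℕ} [NeZero n] (Φ : Op n → Op n)
    (P : (ZMod n → Fin 2) → ℝ) : Prop where
  nonneg : ∀ j, 0 ≤ P j
  sum_eq_one : ∑ j, P j = 1
  map_eq : ∀ ρ, Φ ρ = ∑ j, (P j : ℂ) • tensorMap (fun i => tau (j i)) ρ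

/-- The expected number of depolarized qubits (ones of `j`) under the law `P`. -/
def expectedDepolarized {n : ℕ} [NeZero n] (P : (ZMod n → Fin 2) → ℝ) : ℝ :=
  ∑ j, P j * ((Finset.univ.filter fun i => j i = 1).card : ℝ)

end NoisyCircuit

end

noncomputable section

namespace NoisyCircuit

/-! ### Random maps on bit strings -/

/-! The circuit is nested: a layer U, then everything inside, then U†. It can therefore be averaged
from the middle outwards. The Haar average of X ↦ U†M(UXU†)U commutes with all unitary conjugations,
hence equals α·id + β·tr(·)I (`exists_eq_smul_add_trace_smul_one`); preservation of the trace and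
the trace of M as a superoperator determine α and β. For M = τ_a ⊗ τ_b the result is that both
indices become max(a,b) with probability 4/5 and min(a,b) with probability 1/5
(`gateTwirl_pairMap_tau`), while noise turns each zero into a one with probability p. The averaged
channel is thus described by a monotone Markov chain on bit strings started at the empty string
(`entryMean_nestedCircuit`), and ⟨q⟩ is the sum over sites of the probability of ending up occupied.

For one target site, monotonicity allows noise to be discarded wherever convenient. The ends of an
occupied interval then perform independent walks, outwards with probability 4/5 and inwards with
probability 1/5. A single site becomes a pair with probability 4/5, and a pair never dies out with
probability 15/16; the product 3/4 is the threshold for c. Since the walks have outward drift, a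
surviving interval covers all sites at distance at most a fixed fraction of the elapsed time
(`le_evolve_of_covers`, `le_evolve_of_occupied`). Hence every flip in a space-time window of order h
× h, where h = D/2, occupies the target with probability at least c, and all these flips fail to
occur with probability (1-p) to a power of order D² (`sub_evolve_zero_le`). Short circuits need only
one flip, at the cost of a smaller κ. Uniqueness of P holds because each P(j) can be read off from
one matrix entry. -/

lemma sum_pi_prod {ι κ R : Type*} [Fintype ι] [DecidableEq ι] [Fintype κ] [CommSemiring R]
    (f : ι → κ → R) : ∑ ω : ι → κ, ∏ i, f i (ω i) = ∏ i, ∑ a, f i a := by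
  rw [Finset.prod_univ_sum, Fintype.piFinset_univ]

/-- A bit is flipped to one with probability `p`. -/
def flipWeight (p : ℝ) (a : Fin 2) : ℝ := if a = 0 then 1 - p else p

/-- The coin deciding whether a pair of bits is replaced by its maximum or its minimum. -/
def coinWeight (b : Bool) : ℝ := if b then 4 / 5 else 1 / 5

lemma flipWeight_nonneg {p : ℝ} (h0 : 0 ≤ p) (h1 : p ≤ 1) (a : Fin 2) : 0 ≤ flipWeight p a := by
  unfold flipWeight; split_ifs <;> linarith

lemma coinWeight_nonneg (b : Bool) : 0 ≤ coinWeight b := by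
  cases b <;> norm_num [coinWeight]

lemma sum_flipWeight (p : ℝ) : ∑ a, flipWeight p a = 1 := by
  simp [flipWeight]

lemma sum_coinWeight : ∑ b, coinWeight b = 1 := by
  norm_num [coinWeight]

lemma sum_prod_weight {ι κ : Type*} [Fintype ι] [DecidableEq ι] [Fintype κ] {w : κ → ℝ}
    (hw : ∑ a, w a = 1) : ∑ ω : ι → κ, ∏ i, w (ω i) = 1 := by
  rw [sum_pi_prod (fun _ => w)]; simp [hw]

/-- Two coordinates of an independent family are independent. -/
lemma sum_prod_weight_mul_mul {ι κ : Type*} [Fintype ι] [DecidableEq ι] [Fintype κ] {w : κ → ℝ}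
    (hw : ∑ a, w a = 1) {k l : ι} (hkl : k ≠ l) (A B : κ → ℝ) :
    ∑ ω : ι → κ, (∏ i, w (ω i)) * (A (ω k) * B (ω l)) =
      (∑ a, w a * A a) * ∑ a, w a * B a := by
  have h := sum_pi_prod (ι := ι) (κ := κ) (R := ℝ)
    fun i a => w a * ((if i = k then A a else 1) * (if i = l then B a else 1))
  have hl : ∀ ω : ι → κ, ∏ i, w (ω i) * ((if i = k then A (ω i) else 1) *
      (if i = l then B (ω i) else 1)) = (∏ i, w (ω i)) * (A (ω k) * B (ω l)) := by
    intro ω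
    simp only [Finset.prod_mul_distrib, Finset.prod_ite_eq', Finset.mem_univ, if_true]
  simp only [hl] at h
  rw [h, Fintype.prod_eq_mul k l hkl]
  · simp [hkl, hkl.symm]
  · rintro i ⟨hik, hil⟩
    simp [hik, hil, hw]

lemma sum_prod_weight_mul {ι κ : Type*} [Fintype ι] [DecidableEq ι] [Fintype κ] {w : κ → ℝ}
    (hw : ∑ a, w a = 1) (k : ι) (A : κ → ℝ) :
    ∑ ω : ι → κ, (∏ i, w (ω i)) * A (ω k) = ∑ a, w a * A a := by
  have h := sum_pi_prod (ι := ι) (κ := κ) (R := ℝ) fun i a => w a * (if i = k then A a else 1)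
  have hl : ∀ ω : ι → κ, ∏ i, w (ω i) * (if i = k then A (ω i) else 1)
      = (∏ i, w (ω i)) * A (ω k) := by
    intro ω
    simp only [Finset.prod_mul_distrib, Finset.prod_ite_eq', Finset.mem_univ, if_true]
  simp only [hl] at h
  rw [h, Fintype.prod_eq_single k]
  · simp
  · intro i hik
    simp [hik, hw]

/-- The law of `g ω j` when `j` has law `P` and `ω` has law `w`. -/
def push {Ω C : Type*} [Fintype Ω] [Fintype C] [DecidableEq C] (w : Ω → ℝ) (g : Ω → C → C)
    (P : C → ℝ) (j' : C) : ℝ :=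
  ∑ j, ∑ ω, P j * (w ω * if g ω j = j' then 1 else 0)

section push

variable {Ω C : Type*} [Fintype Ω] [Fintype C] [DecidableEq C] {w : Ω → ℝ} {g : Ω → C → C}

/-- Duality between pushing a law forward and averaging an observable. Values in a general module
serve both expectations of real functions and mixtures of channels. -/
lemma sum_push_smul {M : Type*} [AddCommGroup M] [Module ℝ M] (P : C → ℝ) (F : C → M) :
    ∑ j, push w g P j • F j = ∑ j, P j • ∑ ω, w ω • F (g ω j) := by
  simp only [push, Finset.sum_smul]
  rw [Finset.sum_comm]
  refine Finset.sum_congr rfl fun j _ => ?_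
  rw [Finset.sum_comm, Finset.smul_sum]
  refine Finset.sum_congr rfl fun ω _ => ?_
  simp [mul_smul, ite_smul]

lemma push_nonneg (hw : ∀ ω, 0 ≤ w ω) {P : C → ℝ} (hP : ∀ j, 0 ≤ P j) (j : C) :
    0 ≤ push w g P j := by
  refine Finset.sum_nonneg fun i _ => Finset.sum_nonneg fun ω _ => mul_nonneg (hP i) ?_
  split_ifs <;> simp [hw]

lemma sum_push (hw : ∑ ω, w ω = 1) (P : C → ℝ) : ∑ j, push w g P j = ∑ j, P j := by
  have h := sum_push_smul (w := w) (g := g) P (fun _ => (1 : ℝ))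
  simpa [hw] using h

end push

/-! ### Pairs of neighbouring sites -/

section pairs

variable {n : ℕ} [NeZero n]

/-- The two sites of the `k`-th bond of layer `s`. -/
def pairSite (s : ℕ) (k : Fin (n / 2)) (b : Fin 2) : ZMod n :=
  ((2 * (k : ℕ) + s + (b : ℕ) : ℕ) : ZMod n)

/-- The bonds of a layer partition the ring. -/
def pairEquiv (hn : Even n) (s : ℕ) : Fin (n / 2) × Fin 2 ≃ ZMod n :=
  Equiv.ofBijective (fun q => pairSite s q.1 q.2) <| by
    have h2 := Nat.div_two_mul_two_of_even hn
    rw [Fintype.bijective_iff_surjective_and_card]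
    refine ⟨fun i => ?_, by simp [ZMod.card, h2]⟩
    have hv : (i - (s : ZMod n)).val < n := ZMod.val_lt _
    refine ⟨⟨⟨(i - (s : ZMod n)).val / 2, by omega⟩,
      ⟨(i - (s : ZMod n)).val % 2, by omega⟩⟩, ?_⟩
    have h : 2 * ((i - (s : ZMod n)).val / 2) + s + (i - (s : ZMod n)).val % 2
        = (i - (s : ZMod n)).val + s := by omega
    simp only [pairSite]
    rw [h]
    simp

@[simp] lemma pairEquiv_apply (hn : Even n) (s : ℕ) (q : Fin (n / 2) × Fin 2) :
    pairEquiv hn s q = pairSite s q.1 q.2 := rfl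

@[simp] lemma pairEquiv_symm_pairSite (hn : Even n) (s : ℕ) (k : Fin (n / 2)) (b : Fin 2) :
    (pairEquiv hn s).symm (pairSite s k b) = (k, b) := by
  rw [Equiv.symm_apply_eq, pairEquiv_apply]

/-- Bonds are addressed by integers lifting the ring, so that intervals can be followed without
wrap-around; the bond number (z - s)/2 is reduced modulo n/2. -/
lemma exists_pairSite (hn : Even n) (s : ℕ) {z : ℤ} (hz : 2 ∣ z - s) :
    ∃ k : Fin (n / 2), pairSite s k 0 = (z : ZMod n) ∧ pairSite s k 1 = ((z + 1 : ℤ) : ZMod n) := by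
  obtain ⟨q, hq⟩ := hz
  have h2 := Nat.div_two_mul_two_of_even hn
  have hpos : 0 < n / 2 := by have := NeZero.pos n; omega
  have hk0 : 0 ≤ q % ((n / 2 : ℕ) : ℤ) := Int.emod_nonneg _ (by omega)
  have hk1 : q % ((n / 2 : ℕ) : ℤ) < (n / 2 : ℕ) := Int.emod_lt_of_pos _ (by omega)
  obtain ⟨k, hk⟩ := Int.eq_ofNat_of_zero_le hk0
  have hkn : k < n / 2 := by omega
  have hkey : (((2 * k + s : ℕ) : ℤ) : ZMod n) = (z : ZMod n) := by
    rw [ZMod.intCast_eq_intCast_iff_dvd_sub]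
    refine ⟨q / ((n / 2 : ℕ) : ℤ), ?_⟩
    have := Int.emod_add_mul_ediv q ((n / 2 : ℕ) : ℤ)
    rw [hk] at this
    have hz' : z = s + 2 * q := by linarith
    have hn2 : (n : ℤ) = ((n / 2 : ℕ) : ℤ) * 2 := by exact_mod_cast h2.symm
    rw [hz', hn2]
    push_cast at this ⊢
    linear_combination -2 * this
  refine ⟨⟨k, hkn⟩, ?_, ?_⟩
  · simp only [pairSite, Fin.val_zero, add_zero]
    rw [← hkey]; simp
  · simp only [pairSite, Fin.val_one]
    rw [Int.cast_add, ← hkey]; simp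

/-- Every pair of bits is replaced by its maximum or its minimum, as told by a coin. -/
def merge (hn : Even n) (s : ℕ) (ω : Fin (n / 2) → Bool) (j : ZMod n → Fin 2) : ZMod n → Fin 2 :=
  fun i =>
    let k := ((pairEquiv hn s).symm i).1
    if ω k then max (j (pairSite s k 0)) (j (pairSite s k 1))
    else min (j (pairSite s k 0)) (j (pairSite s k 1))

lemma merge_pairSite (hn : Even n) (s : ℕ) (ω : Fin (n / 2) → Bool) (j : ZMod n → Fin 2)
    (k : Fin (n / 2)) (b : Fin 2) :
    merge hn s ω j (pairSite s k b) =
      if ω k then max (j (pairSite s k 0)) (j (pairSite s k 1))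
      else min (j (pairSite s k 0)) (j (pairSite s k 1)) := by
  simp [merge]

lemma merge_mono (hn : Even n) (s : ℕ) (ω : Fin (n / 2) → Bool) : Monotone (merge hn s ω) := by
  intro j j' h i
  simp only [merge]
  split_ifs
  · exact max_le_max (h _) (h _)
  · exact min_le_min (h _) (h _)

@[simp] lemma merge_zero (hn : Even n) (s : ℕ) (ω : Fin (n / 2) → Bool) :
    merge hn s ω 0 = 0 := by
  funext i; simp [merge]

/-! ### The process of depolarized sites -/

/-- The expectation of `f` after independent flips. -/
def flipAvg (p : ℝ) (f : (ZMod n → Fin 2) → ℝ) (j : ZMod n → Fin 2) : ℝ :=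
  ∑ η : ZMod n → Fin 2, (∏ i, flipWeight p (η i)) • f (j ⊔ η)

/-- The expectation of `f` after merging the pairs of layer `s`. -/
def mergeAvg (hn : Even n) (s : ℕ) (f : (ZMod n → Fin 2) → ℝ) (j : ZMod n → Fin 2) : ℝ :=
  ∑ ω : Fin (n / 2) → Bool, (∏ k, coinWeight (ω k)) • f (merge hn s ω j)

/-- The law after independent flips. -/
def flipPush (p : ℝ) : ((ZMod n → Fin 2) → ℝ) → (ZMod n → Fin 2) → ℝ :=
  push (fun η : ZMod n → Fin 2 => ∏ i, flipWeight p (η i)) (fun η j => j ⊔ η)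

/-- The law after merging the pairs of layer `s`. -/
def mergePush (hn : Even n) (s : ℕ) : ((ZMod n → Fin 2) → ℝ) → (ZMod n → Fin 2) → ℝ :=
  push (fun ω : Fin (n / 2) → Bool => ∏ k, coinWeight (ω k)) (merge hn s)

lemma sum_flipPush_smul {M : Type*} [AddCommGroup M] [Module ℝ M] (p : ℝ)
    (P : (ZMod n → Fin 2) → ℝ) (F : (ZMod n → Fin 2) → M) :
    ∑ j, flipPush p P j • F j =
      ∑ j, P j • ∑ η : ZMod n → Fin 2, (∏ i, flipWeight p (η i)) • F (j ⊔ η) :=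
  sum_push_smul P F

lemma sum_mergePush_smul {M : Type*} [AddCommGroup M] [Module ℝ M] (hn : Even n) (s : ℕ)
    (P : (ZMod n → Fin 2) → ℝ) (F : (ZMod n → Fin 2) → M) :
    ∑ j, mergePush hn s P j • F j =
      ∑ j, P j • ∑ ω : Fin (n / 2) → Bool, (∏ k, coinWeight (ω k)) • F (merge hn s ω j) :=
  sum_push_smul P F

/-- The law of the depolarized sites of the averaged circuit consisting of the layers
`s, …, s + h - 1` and their inverses. -/
def circuitLaw (hn : Even n) (p : ℝ) : ℕ → ℕ → (ZMod n → Fin 2) → ℝ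
  | _, 0 => Pi.single 0 1
  | s, h + 1 => flipPush p (mergePush hn s (flipPush p (circuitLaw hn p (s + 1) h)))

/-- The observable `f` evolved backwards through the layers `0, …, s - 1`. -/
def evolve (hn : Even n) (p : ℝ) (f : (ZMod n → Fin 2) → ℝ) : ℕ → (ZMod n → Fin 2) → ℝ
  | 0 => f
  | s + 1 => flipAvg p (mergeAvg hn s (flipAvg p (evolve hn p f s)))

lemma circuitLaw_nonneg (hn : Even n) {p : ℝ} (h0 : 0 ≤ p) (h1 : p ≤ 1) (h : ℕ) :
    ∀ s j, 0 ≤ circuitLaw hn p s h j := by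
  induction h with
  | zero => intro s j; simp only [circuitLaw, Pi.single_apply]; split_ifs <;> norm_num
  | succ h ih =>
    intro s j
    have hf : ∀ η : ZMod n → Fin 2, 0 ≤ ∏ i, flipWeight p (η i) := fun η =>
      Finset.prod_nonneg fun i _ => flipWeight_nonneg h0 h1 _
    exact push_nonneg hf (push_nonneg
      (fun ω => Finset.prod_nonneg fun i _ => coinWeight_nonneg _) (push_nonneg hf (ih _))) j

lemma sum_circuitLaw (hn : Even n) (p : ℝ) (h : ℕ) : ∀ s, ∑ j, circuitLaw hn p s h j = 1 := by
  induction h with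
  | zero => intro s; simp [circuitLaw]
  | succ h ih =>
    intro s
    simp only [circuitLaw, flipPush, mergePush]
    rw [sum_push (sum_prod_weight (sum_flipWeight p)), sum_push (sum_prod_weight sum_coinWeight),
      sum_push (sum_prod_weight (sum_flipWeight p)), ih]

/-- The law has run through layers s + h - 1 down to s, and the observable accounts for s - 1 down
to 0; moving layer s from one side to the other leaves the sum unchanged. -/
lemma sum_circuitLaw_mul (hn : Even n) (p : ℝ) (f : (ZMod n → Fin 2) → ℝ) (h : ℕ) :
    ∀ s, ∑ j, circuitLaw hn p s h j • evolve hn p f s j = evolve hn p f (s + h) 0 := by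
  induction h with
  | zero => intro s; simp [circuitLaw, Pi.single_apply]
  | succ h ih =>
    intro s
    have e : s + (h + 1) = s + 1 + h := by ring
    rw [e, ← ih (s + 1)]
    simp only [circuitLaw]
    rw [sum_flipPush_smul, sum_mergePush_smul, sum_flipPush_smul]
    rfl

/-! ### Monotone observables and the effect of noise on the empty configuration -/

section monotone

variable {p : ℝ} {f : (ZMod n → Fin 2) → ℝ}

lemma flipAvg_mono (h0 : 0 ≤ p) (h1 : p ≤ 1) (hf : Monotone f) : Monotone (flipAvg p f) := by
  intro j j' h
  refine Finset.sum_le_sum fun η _ => ?_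
  exact mul_le_mul_of_nonneg_left (hf (sup_le_sup_right h η))
    (Finset.prod_nonneg fun i _ => flipWeight_nonneg h0 h1 _)

lemma mergeAvg_mono (hn : Even n) (s : ℕ) (hf : Monotone f) : Monotone (mergeAvg hn s f) := by
  intro j j' h
  refine Finset.sum_le_sum fun ω _ => ?_
  exact mul_le_mul_of_nonneg_left (hf (merge_mono hn s ω h))
    (Finset.prod_nonneg fun i _ => coinWeight_nonneg _)

lemma le_flipAvg (h0 : 0 ≤ p) (h1 : p ≤ 1) (hf : Monotone f) (j : ZMod n → Fin 2) :
    f j ≤ flipAvg p f j := by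
  calc f j = ∑ η : ZMod n → Fin 2, (∏ i, flipWeight p (η i)) • f j := by
        rw [← Finset.sum_smul, sum_prod_weight (sum_flipWeight p), one_smul]
    _ ≤ _ := Finset.sum_le_sum fun η _ => mul_le_mul_of_nonneg_left (hf le_sup_left)
        (Finset.prod_nonneg fun i _ => flipWeight_nonneg h0 h1 _)

lemma mergeAvg_le_mergeAvg (hn : Even n) (s : ℕ) {g : (ZMod n → Fin 2) → ℝ} (hfg : ∀ j, f j ≤ g j)
    (j : ZMod n → Fin 2) : mergeAvg hn s f j ≤ mergeAvg hn s g j :=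
  Finset.sum_le_sum fun _ _ => mul_le_mul_of_nonneg_left (hfg _)
    (Finset.prod_nonneg fun _ _ => coinWeight_nonneg _)

lemma mergeAvg_zero (hn : Even n) (s : ℕ) : mergeAvg hn s f 0 = f 0 := by
  simp only [mergeAvg, merge_zero]
  rw [← Finset.sum_smul, sum_prod_weight sum_coinWeight, one_smul]

lemma evolve_mono (hn : Even n) (h0 : 0 ≤ p) (h1 : p ≤ 1) (hf : Monotone f) :
    ∀ s, Monotone (evolve hn p f s)
  | 0 => hf
  | s + 1 => flipAvg_mono h0 h1 (mergeAvg_mono hn s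
      (flipAvg_mono h0 h1 (evolve_mono hn h0 h1 hf s)))

/-- Flips only raise a monotone observable, so both noise rounds of the layer may be dropped. -/
lemma mergeAvg_evolve_le (hn : Even n) (h0 : 0 ≤ p) (h1 : p ≤ 1) (hf : Monotone f) (s : ℕ)
    (j : ZMod n → Fin 2) : mergeAvg hn s (evolve hn p f s) j ≤ evolve hn p f (s + 1) j := by
  have hm := evolve_mono hn h0 h1 hf s
  exact (mergeAvg_le_mergeAvg hn s (le_flipAvg h0 h1 hm) j).trans
    (le_flipAvg h0 h1 (mergeAvg_mono hn s (flipAvg_mono h0 h1 hm)) j)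

/-- Merging fixes the empty configuration. Of the two noise rounds only the one after the merge is
kept. -/
lemma flipAvg_evolve_zero_le (hn : Even n) (h0 : 0 ≤ p) (h1 : p ≤ 1) (hf : Monotone f) (s : ℕ) :
    flipAvg p (evolve hn p f s) 0 ≤ evolve hn p f (s + 1) 0 := by
  have hm := evolve_mono hn h0 h1 hf s
  refine le_trans ?_ (le_flipAvg h0 h1 (mergeAvg_mono hn s (flipAvg_mono h0 h1 hm)) 0)
  rw [mergeAvg_zero]

lemma evolve_zero_mono (hn : Even n) (h0 : 0 ≤ p) (h1 : p ≤ 1) (hf : Monotone f) :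
    Monotone fun s => evolve hn p f s 0 :=
  monotone_nat_of_le_succ fun s => (le_flipAvg h0 h1 (evolve_mono hn h0 h1 hf s) 0).trans
    (flipAvg_evolve_zero_le hn h0 h1 hf s)

lemma evolve_nonneg (hn : Even n) (h0 : 0 ≤ p) (h1 : p ≤ 1) (hf : Monotone f) (hf0 : 0 ≤ f 0)
    (s : ℕ) (j : ZMod n → Fin 2) : 0 ≤ evolve hn p f s j :=
  (hf0.trans (evolve_zero_mono hn h0 h1 hf (Nat.zero_le s))).trans
    (evolve_mono hn h0 h1 hf s (fun _ => Fin.zero_le _))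

/-- If `f ≥ c` as soon as some site of `A` is occupied, flips bring the value at the empty
configuration closer to `c` by a factor `(1 - p) ^ |A|`. -/
lemma sub_flipAvg_zero_le (h0 : 0 ≤ p) (h1 : p ≤ 1) (hf : Monotone f) {c : ℝ}
    (A : Finset (ZMod n)) (hA : ∀ y ∈ A, ∀ j : ZMod n → Fin 2, j y = 1 → c ≤ f j) :
    c - flipAvg p f 0 ≤ (1 - p) ^ A.card * (c - f 0) := by
  have hsum : ∑ η : ZMod n → Fin 2, (∏ i, flipWeight p (η i)) *
      (∏ i, if i ∈ A ∧ η i = 1 then (0 : ℝ) else 1) = (1 - p) ^ A.card := by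
    simp only [← Finset.prod_mul_distrib]
    rw [sum_pi_prod fun (i : ZMod n) (a : Fin 2) =>
      flipWeight p a * (if i ∈ A ∧ a = 1 then (0 : ℝ) else 1)]
    have : ∀ i : ZMod n, ∑ a : Fin 2, flipWeight p a * (if i ∈ A ∧ a = 1 then (0 : ℝ) else 1)
        = if i ∈ A then 1 - p else 1 := by
      intro i
      by_cases hi : i ∈ A <;> simp [hi, flipWeight]
    rw [Finset.prod_congr rfl fun i _ => this i]
    simp
  -- The product is the indicator that no flip hits `A`; on that event only monotonicity is used.
  have hlow : ∀ η : ZMod n → Fin 2,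
      c + (∏ i, if i ∈ A ∧ η i = 1 then (0 : ℝ) else 1) * (f 0 - c) ≤ f (0 ⊔ η) := by
    intro η
    by_cases h : ∃ y ∈ A, η y = 1
    · obtain ⟨y, hy, hη⟩ := h
      rw [Finset.prod_eq_zero (Finset.mem_univ y) (by simp [hy, hη])]
      simpa using hA y hy (0 ⊔ η) (by simp [hη])
    · push Not at h
      rw [Finset.prod_eq_one fun i _ => by
        rw [if_neg]; rintro ⟨hi, hi'⟩; exact h i hi hi']
      simpa using hf (le_sup_left : (0 : ZMod n → Fin 2) ≤ 0 ⊔ η)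
  have hfin : ∑ η : ZMod n → Fin 2, (∏ i, flipWeight p (η i)) •
      (c + (∏ i, if i ∈ A ∧ η i = 1 then (0 : ℝ) else 1) * (f 0 - c)) ≤ flipAvg p f 0 :=
    Finset.sum_le_sum fun η _ => mul_le_mul_of_nonneg_left (hlow η)
      (Finset.prod_nonneg fun i _ => flipWeight_nonneg h0 h1 _)
  simp only [smul_eq_mul, mul_add, ← mul_assoc, Finset.sum_add_distrib, ← Finset.sum_mul,
    sum_prod_weight (sum_flipWeight p), hsum] at hfin
  linarith

/-- Each of the `k` rounds gives `q` fresh chances of a flip in `A`, and the gap to `c` shrinks by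
the probability of missing them all. -/
lemma sub_evolve_zero_le (hn : Even n) (h0 : 0 ≤ p) (h1 : p ≤ 1) (hf : Monotone f) {c : ℝ}
    {s k q : ℕ} (A : Finset (ZMod n)) (hq : A.card = q)
    (hA : ∀ r, s ≤ r → r < s + k → ∀ y ∈ A, ∀ j : ZMod n → Fin 2, j y = 1 → c ≤ evolve hn p f r j) :
    c - evolve hn p f (s + k) 0 ≤ (1 - p) ^ (q * k) * (c - evolve hn p f s 0) := by
  induction k with
  | zero => simp
  | succ k ih =>
    have h := sub_flipAvg_zero_le h0 h1 (evolve_mono hn h0 h1 hf (s + k)) A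
      (hA (s + k) (by omega) (by omega))
    have h' := flipAvg_evolve_zero_le hn h0 h1 hf (s + k)
    have ih := ih fun r hr hr' => hA r hr (by omega)
    rw [hq] at h
    have : (1 - p) ^ q * (c - evolve hn p f (s + k) 0) ≤
        (1 - p) ^ q * ((1 - p) ^ (q * k) * (c - evolve hn p f s 0)) :=
      mul_le_mul_of_nonneg_left ih (pow_nonneg (by linarith) _)
    rw [← add_assoc, Nat.mul_succ, pow_add]
    linarith

end monotone

end pairs

/-! ### Growth of depolarized intervals -/

section growth

variable {n : ℕ} [NeZero n]

/-- The indicator that site `i` is occupied. -/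
def occupied (i : ZMod n) (j : ZMod n → Fin 2) : ℝ := if j i = 1 then 1 else 0

lemma occupied_mono (i : ZMod n) : Monotone (occupied i) := by
  intro j j' h
  have hi := h i
  unfold occupied
  split_ifs with h1 h2
  · exact le_rfl
  · rw [h1] at hi
    exact absurd (le_antisymm (Fin.le_last _) hi) h2
  · exact zero_le_one
  · exact le_rfl

lemma max_eq_one_left {a : Fin 2} (b : Fin 2) (h : a = 1) : max a b = 1 := by
  subst h; revert b; decide

lemma max_eq_one_right (a : Fin 2) {b : Fin 2} (h : b = 1) : max a b = 1 := by
  subst h; revert a; decide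

lemma merge_eq_one_of_coin (hn : Even n) {s : ℕ} {ω : Fin (n / 2) → Bool} {j : ZMod n → Fin 2}
    {k : Fin (n / 2)} (hω : ω k = true) {b : Fin 2} (hj : j (pairSite s k b) = 1) (b' : Fin 2) :
    merge hn s ω j (pairSite s k b') = 1 := by
  rw [merge_pairSite, if_pos hω]
  fin_cases b
  · exact max_eq_one_left _ hj
  · exact max_eq_one_right _ hj

lemma merge_eq_one (hn : Even n) {s : ℕ} (ω : Fin (n / 2) → Bool) {j : ZMod n → Fin 2}
    {k : Fin (n / 2)} (h0 : j (pairSite s k 0) = 1) (h1 : j (pairSite s k 1) = 1) (b : Fin 2) :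
    merge hn s ω j (pairSite s k b) = 1 := by
  rw [merge_pairSite, h0, h1]; simp

/-- The configuration `j` is one on the image of the interval `[l, e)` of integers. -/
def Covers (j : ZMod n → Fin 2) (l e : ℤ) : Prop := ∀ z : ℤ, l ≤ z → z < e → j (z : ZMod n) = 1

/-- Both ends of an interval move outwards or inwards by one site, depending on their coins. -/
lemma covers_merge (hn : Even n) {s : ℕ} (ω : Fin (n / 2) → Bool) {j : ZMod n → Fin 2}
    {l e : ℤ} (hle : l < e) (hl : 2 ∣ l - 1 - s) (he : 2 ∣ e - 1 - s) (hj : Covers j l e)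
    {k₁ k₂ : Fin (n / 2)} (hk₁ : pairSite s k₁ 0 = ((l - 1 : ℤ) : ZMod n))
    (hk₁' : pairSite s k₁ 1 = ((l - 1 + 1 : ℤ) : ZMod n))
    (hk₂ : pairSite s k₂ 0 = ((e - 1 : ℤ) : ZMod n))
    (hk₂' : pairSite s k₂ 1 = ((e - 1 + 1 : ℤ) : ZMod n)) :
    Covers (merge hn s ω j) (if ω k₁ then l - 1 else l + 1) (if ω k₂ then e + 1 else e - 1) := by
  -- Here z is the left site of a bond. By parity each relevant bond lies inside the interval or
  -- straddles an end; a straddling bond is needed only if its coin selects the maximum.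
  have key : ∀ z : ℤ, 2 ∣ z - s → l - 1 ≤ z → z ≤ e - 1 → (z = l - 1 → ω k₁ = true) →
      (z = e - 1 → ω k₂ = true) →
      merge hn s ω j (z : ZMod n) = 1 ∧ merge hn s ω j ((z + 1 : ℤ) : ZMod n) = 1 := by
    intro z hz hz1 hz2 h1 h2
    rcases eq_or_ne z (l - 1) with h | h
    · subst h
      have hl1 : j (pairSite s k₁ 1) = 1 := by
        rw [hk₁']; exact hj _ (by omega) (by omega)
      rw [← hk₁, ← hk₁']
      exact ⟨merge_eq_one_of_coin hn (h1 rfl) hl1 0, merge_eq_one_of_coin hn (h1 rfl) hl1 1⟩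
    rcases eq_or_ne z (e - 1) with h' | h'
    · subst h'
      have hl1 : j (pairSite s k₂ 0) = 1 := by
        rw [hk₂]; exact hj _ (by omega) (by omega)
      rw [← hk₂, ← hk₂']
      exact ⟨merge_eq_one_of_coin hn (h2 rfl) hl1 0, merge_eq_one_of_coin hn (h2 rfl) hl1 1⟩
    · obtain ⟨k, hk, hk'⟩ := exists_pairSite hn s hz
      have e0 : j (pairSite s k 0) = 1 := by rw [hk]; exact hj _ (by omega) (by omega)
      have e1 : j (pairSite s k 1) = 1 := by rw [hk']; exact hj _ (by omega) (by omega)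
      rw [← hk, ← hk']
      exact ⟨merge_eq_one hn ω e0 e1 0, merge_eq_one hn ω e0 e1 1⟩
  intro z hz1 hz2
  by_cases hz : (2 : ℤ) ∣ z - s
  · refine (key z hz ?_ ?_ ?_ ?_).1 <;> split_ifs at hz1 hz2 <;> first | omega | (intros; simp_all)
  · have := (key (z - 1) (by omega) ?_ ?_ ?_ ?_).2
    · simpa using this
    all_goals split_ifs at hz1 hz2 <;> first | omega | (intros; simp_all)

/-- The probability that a given site ends up occupied, starting from an occupied interval, is
bounded below by a solution of the recursion for the two independent random walks performed by the
ends of the interval. -/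
lemma le_evolve_of_covers (hn : Even n) {p : ℝ} (h0 : 0 ≤ p) (h1 : p ≤ 1) (x : ℤ) (s : ℕ) :
    ∀ (l : ℤ) (m : ℕ) (j : ZMod n → Fin 2), 2 ∣ l - s → 2 * m + 2 * s ≤ n →
      Covers j l (l + 2 * m) →
      1 - (1 / 16 : ℝ) ^ m - (2 : ℝ) ^ (l - x) * (4 / 5) ^ s
        - (2 : ℝ) ^ (x + 1 - (l + 2 * m)) * (4 / 5) ^ s ≤
        evolve hn p (occupied (x : ZMod n)) s j := by
  induction s with
  | zero =>
    intro l m j _ _ hj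
    have hA : (0 : ℝ) < (1 / 16 : ℝ) ^ m := by positivity
    have hB : (0 : ℝ) < (2 : ℝ) ^ (l - x) := by positivity
    have hC : (0 : ℝ) < (2 : ℝ) ^ (x + 1 - (l + 2 * m)) := by positivity
    simp only [evolve, occupied, pow_zero, mul_one]
    -- If x lies outside the interval, one of the two exponential terms is at least 1 and the bound
    -- is negative.
    by_cases hx : l ≤ x ∧ x < l + 2 * m
    · rw [if_pos (hj x hx.1 hx.2)]; linarith
    · have : (1 : ℝ) ≤ (2 : ℝ) ^ (l - x) ∨ (1 : ℝ) ≤ (2 : ℝ) ^ (x + 1 - (l + 2 * m)) := by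
        rcases not_and_or.1 hx with h | h
        · exact Or.inl (one_le_zpow₀ one_le_two (by omega))
        · exact Or.inr (one_le_zpow₀ one_le_two (by omega))
      have hpos : (0 : ℝ) ≤ if j (x : ZMod n) = 1 then 1 else 0 := by split_ifs <;> norm_num
      rcases this with h | h <;> linarith
  | succ s ih =>
    intro l m j hl hm hj
    -- For an empty interval the term (1/16)^0 = 1 makes the bound trivial.
    rcases m with _ | m
    · have hB : (0 : ℝ) < (2 : ℝ) ^ (l - x) * (4 / 5) ^ (s + 1) := by positivity
      have hC : (0 : ℝ) < (2 : ℝ) ^ (x + 1 - (l + 2 * (0 : ℕ))) * (4 / 5) ^ (s + 1) := by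
        positivity
      have := evolve_nonneg hn h0 h1 (occupied_mono (x : ZMod n)) (by simp [occupied]) (s + 1) j
      simp only [pow_zero]
      linarith
    · refine le_trans ?_ (mergeAvg_evolve_le hn h0 h1 (occupied_mono _) s j)
      set e : ℤ := l + 2 * (m + 1 : ℕ) with he
      push_cast at hl he
      obtain ⟨k₁, hk₁, hk₁'⟩ := exists_pairSite hn s (z := l - 1) (by omega)
      obtain ⟨k₂, hk₂, hk₂'⟩ := exists_pairSite hn s (z := e - 1) (by omega)
      -- The condition 2m + 2s ≤ n keeps the interval shorter than the ring, so its two ends are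
      -- moved by different, hence independent, coins.
      have hne : k₁ ≠ k₂ := by
        rintro rfl
        rw [hk₁, ZMod.intCast_eq_intCast_iff_dvd_sub] at hk₂
        have := Int.le_of_dvd (by omega) hk₂
        omega
      have hcov := fun ω => covers_merge hn ω (by omega) (by omega) (by omega) hj hk₁ hk₁' hk₂ hk₂'
      -- Factors contributed by the move of one end. Half-length m results when both ends move
      -- inwards, and each outward move adds one. The means are 4/5·1/16 + 1/5 = 1/4, which squared
      -- over the two ends restores 1/16, and 4/5·1/2 + 1/5·2 = 4/5, the decay per layer.
      let A : Bool → ℝ := fun a => if a then 1 / 16 else 1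
      let B : Bool → ℝ := fun a => if a then 1 / 2 else 2
      have hlow : ∀ ω : Fin (n / 2) → Bool,
          1 - (1 / 16 : ℝ) ^ m * (A (ω k₁) * A (ω k₂))
            - (2 : ℝ) ^ (l - x) * (4 / 5) ^ s * B (ω k₁)
            - (2 : ℝ) ^ (x + 1 - e) * (4 / 5) ^ s * B (ω k₂) ≤
            evolve hn p (occupied (x : ZMod n)) s (merge hn s ω j) := by
        intro ω
        have hc := hcov ω
        have z1 : ∀ t : ℤ, (2 : ℝ) ^ (t + 1) = 2 ^ t * 2 := fun t => zpow_add_one₀ two_ne_zero t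
        have z2 : ∀ t : ℤ, (2 : ℝ) ^ (t - 1) = 2 ^ t * (1 / 2) := fun t => by
          rw [zpow_sub_one₀ two_ne_zero]; norm_num
        rcases ha : ω k₁ with _ | _ <;> rcases hb : ω k₂ with _ | _ <;>
          simp only [ha, hb, if_true, if_false, Bool.false_eq_true] at hc
        · have := ih (l + 1) m (merge hn s ω j) (by omega) (by omega) (by convert hc using 1; omega)
          rw [show l + 1 - x = l - x + 1 by ring,
            show x + 1 - (l + 1 + 2 * (m : ℤ)) = x + 1 - e + 1 by omega, z1, z1] at this
          simp only [A, B, Bool.false_eq_true, if_false]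
          linarith
        · have := ih (l + 1) (m + 1) (merge hn s ω j) (by omega) (by omega)
            (by convert hc using 1; push_cast; omega)
          rw [show l + 1 - x = l - x + 1 by ring,
            show x + 1 - (l + 1 + 2 * ((m + 1 : ℕ) : ℤ)) = x + 1 - e - 1 by omega,
            z1, z2, pow_succ] at this
          simp only [A, B, Bool.false_eq_true, if_false, if_true]
          linarith
        · have := ih (l - 1) (m + 1) (merge hn s ω j) (by omega) (by omega)
            (by convert hc using 1; push_cast; omega)
          rw [show l - 1 - x = l - x - 1 by ring,
            show x + 1 - (l - 1 + 2 * ((m + 1 : ℕ) : ℤ)) = x + 1 - e + 1 by omega,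
            z1, z2, pow_succ] at this
          simp only [A, B, Bool.false_eq_true, if_false, if_true]
          linarith
        · have := ih (l - 1) (m + 2) (merge hn s ω j) (by omega) (by omega)
            (by convert hc using 1; push_cast; omega)
          rw [show l - 1 - x = l - x - 1 by ring,
            show x + 1 - (l - 1 + 2 * ((m + 2 : ℕ) : ℤ)) = x + 1 - e - 1 by omega,
            z2, z2, pow_add] at this
          simp only [A, B, if_true]
          linarith
      have hsum : ∑ ω : Fin (n / 2) → Bool, (∏ k, coinWeight (ω k)) *
          (1 - (1 / 16 : ℝ) ^ m * (A (ω k₁) * A (ω k₂))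
            - (2 : ℝ) ^ (l - x) * (4 / 5) ^ s * B (ω k₁)
            - (2 : ℝ) ^ (x + 1 - e) * (4 / 5) ^ s * B (ω k₂)) =
          1 - (1 / 16 : ℝ) ^ m * ((∑ a, coinWeight a * A a) * ∑ a, coinWeight a * A a)
            - (2 : ℝ) ^ (l - x) * (4 / 5) ^ s * (∑ a, coinWeight a * B a)
            - (2 : ℝ) ^ (x + 1 - e) * (4 / 5) ^ s * (∑ a, coinWeight a * B a) := by
        simp only [mul_sub, Finset.sum_sub_distrib, mul_one]
        rw [sum_prod_weight sum_coinWeight]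
        simp only [mul_left_comm _ ((1 / 16 : ℝ) ^ m) _,
          mul_left_comm _ ((2 : ℝ) ^ (l - x) * (4 / 5) ^ s) _,
          mul_left_comm _ ((2 : ℝ) ^ (x + 1 - e) * (4 / 5) ^ s) _, ← Finset.mul_sum]
        rw [sum_prod_weight_mul_mul sum_coinWeight hne, sum_prod_weight_mul sum_coinWeight,
          sum_prod_weight_mul sum_coinWeight]
      have hfin : ∑ ω : Fin (n / 2) → Bool, (∏ k, coinWeight (ω k)) *
          (1 - (1 / 16 : ℝ) ^ m * (A (ω k₁) * A (ω k₂))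
            - (2 : ℝ) ^ (l - x) * (4 / 5) ^ s * B (ω k₁)
            - (2 : ℝ) ^ (x + 1 - e) * (4 / 5) ^ s * B (ω k₂)) ≤
          mergeAvg hn s (evolve hn p (occupied (x : ZMod n)) s) j :=
        Finset.sum_le_sum fun ω _ => mul_le_mul_of_nonneg_left (hlow ω)
          (Finset.prod_nonneg fun k _ => coinWeight_nonneg _)
      rw [hsum] at hfin
      refine le_of_eq_of_le ?_ hfin
      simp only [Fintype.sum_bool, coinWeight, A, B, if_true, Bool.false_eq_true, if_false]
      rw [pow_succ, pow_succ]
      ring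

/-- A single occupied site survives and spreads with probability close to `3 / 4`. -/
lemma le_evolve_of_occupied (hn : Even n) {p : ℝ} (h0 : 0 ≤ p) (h1 : p ≤ 1) (x : ℤ) {s q d : ℕ}
    (hs : 2 + 2 * s ≤ n) (hq : 4 * q ≤ s) (hd : d < q) {j : ZMod n → Fin 2}
    (hj : j ((x + d : ℤ) : ZMod n) = 1) :
    3 / 4 - 8 / 5 * (512 / 625 : ℝ) ^ q ≤ evolve hn p (occupied (x : ZMod n)) (s + 1) j := by
  -- l is the left site of the bond of layer s containing x + d.
  obtain ⟨l, hl, hlb⟩ : ∃ l : ℤ, 2 ∣ l - s ∧ (x + d = l ∨ x + d = l + 1) := by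
    by_cases h : (2 : ℤ) ∣ x + d - s
    · exact ⟨x + d, h, Or.inl rfl⟩
    · exact ⟨x + d - 1, by omega, Or.inr (by omega)⟩
  obtain ⟨k, hk, hk'⟩ := exists_pairSite hn s hl
  have hb : ∃ b : Fin 2, j (pairSite s k b) = 1 := by
    rcases hlb with h | h
    · exact ⟨0, by rw [hk, ← h, hj]⟩
    · exact ⟨1, by rw [hk', ← h, hj]⟩
  obtain ⟨b, hb⟩ := hb
  have hcov : ∀ ω : Fin (n / 2) → Bool, ω k = true →
      Covers (merge hn s ω j) l (l + 2 * (1 : ℕ)) := by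
    intro ω hω z hz1 hz2
    push_cast at hz2
    rcases (by omega : z = l ∨ z = l + 1) with rfl | rfl
    · rw [← hk]; exact merge_eq_one_of_coin hn hω hb 0
    · rw [← hk']; exact merge_eq_one_of_coin hn hω hb 1
  -- 15/16 is the bound 1 - (1/16)^m for a pair, m = 1; the coin that creates the pair then gives
  -- 4/5·15/16 = 3/4.
  set H : ℝ := 15 / 16 - 2 * (512 / 625 : ℝ) ^ q with hH
  -- An offset of at most q against at least 4q layers: 2·(4/5)^4 = 512/625 < 1.
  have hpow : ∀ t : ℤ, t ≤ q → (2 : ℝ) ^ t * (4 / 5) ^ s ≤ (512 / 625 : ℝ) ^ q := by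
    intro t ht
    calc (2 : ℝ) ^ t * (4 / 5) ^ s ≤ (2 : ℝ) ^ (q : ℤ) * (4 / 5) ^ (4 * q) :=
          mul_le_mul (zpow_le_zpow_right₀ one_le_two ht)
            (pow_le_pow_of_le_one (by norm_num) (by norm_num) hq) (by positivity) (by positivity)
      _ = (512 / 625 : ℝ) ^ q := by
          rw [zpow_natCast, pow_mul, ← mul_pow]; norm_num
  have hlow : ∀ ω : Fin (n / 2) → Bool, (if ω k then H else 0) ≤
      evolve hn p (occupied (x : ZMod n)) s (merge hn s ω j) := by
    intro ω
    split_ifs with hω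
    · have := le_evolve_of_covers hn h0 h1 x s l 1 _ hl (by omega) (hcov ω hω)
      have e1 := hpow (l - x) (by omega)
      have e2 := hpow (x + 1 - (l + 2 * (1 : ℕ))) (by omega)
      rw [hH]
      linarith
    · exact evolve_nonneg hn h0 h1 (occupied_mono _) (by simp [occupied]) s _
  refine le_trans ?_ (mergeAvg_evolve_le hn h0 h1 (occupied_mono _) s j)
  have hfin : ∑ ω : Fin (n / 2) → Bool, (∏ k, coinWeight (ω k)) * (if ω k then H else 0) ≤
      mergeAvg hn s (evolve hn p (occupied (x : ZMod n)) s) j :=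
    Finset.sum_le_sum fun ω _ => mul_le_mul_of_nonneg_left (hlow ω)
      (Finset.prod_nonneg fun k _ => coinWeight_nonneg _)
  rw [sum_prod_weight_mul sum_coinWeight k fun a => if a then H else 0] at hfin
  refine le_of_eq_of_le ?_ hfin
  simp [coinWeight, hH]
  ring

/-- The probability that a site of a circuit with `2h` layers is depolarized. -/
lemma le_evolve_occupied_zero {c : ℝ} (hc : 0 < c) {q₀ : ℕ} (hq₀ : 1 ≤ q₀)
    (hcq : ∀ q, q₀ ≤ q → c ≤ 3 / 4 - 8 / 5 * (512 / 625 : ℝ) ^ q) (hn : Even n) {p : ℝ}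
    (h0 : 0 ≤ p) (h1 : p ≤ 1) {h : ℕ} (hh : 2 * h < n) (i : ZMod n) :
    c * (1 - (1 - p) ^ (1 / (1024 * (q₀ : ℝ) ^ 2) * (2 * (h : ℝ)) ^ 2)) ≤
      evolve hn p (occupied i) h 0 := by
  have hmono := occupied_mono i
  have hpos : ∀ s j, 0 ≤ evolve hn p (occupied i) s j :=
    evolve_nonneg hn h0 h1 hmono (by simp [occupied])
  have hc1 : c ≤ 1 := by
    have := hcq q₀ le_rfl
    have : (0 : ℝ) < (512 / 625 : ℝ) ^ q₀ := by positivity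
    linarith
  have hq₀' : (1 : ℝ) ≤ q₀ := by exact_mod_cast hq₀
  rcases Nat.eq_zero_or_pos h with rfl | hpos_h
  · simpa using hpos 0 0
  have red : ∀ N : ℕ, 1 / (1024 * (q₀ : ℝ) ^ 2) * (2 * (h : ℝ)) ^ 2 ≤ N →
      c - evolve hn p (occupied i) h 0 ≤ (1 - p) ^ N * c →
      c * (1 - (1 - p) ^ (1 / (1024 * (q₀ : ℝ) ^ 2) * (2 * (h : ℝ)) ^ 2)) ≤
      evolve hn p (occupied i) h 0 := by
    intro N hN hle
    -- The base vanishes for p = 1, where 0^0 = 1 would break monotonicity; the exponent is positive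
    -- because h > 0.
    have : (1 - p) ^ (N : ℝ) ≤ (1 - p) ^ (1 / (1024 * (q₀ : ℝ) ^ 2) * (2 * (h : ℝ)) ^ 2) :=
      Real.rpow_le_rpow_of_exponent_ge_of_imp (by linarith) (by linarith) hN (by
        intro _ h'
        have : (0 : ℝ) < 1 / (1024 * (q₀ : ℝ) ^ 2) * (2 * (h : ℝ)) ^ 2 := by
          have : (0 : ℝ) < h := by exact_mod_cast hpos_h
          positivity
        linarith)
    rw [Real.rpow_natCast] at this
    have := mul_le_mul_of_nonneg_right this hc.le
    linarith
  rcases lt_or_ge h (16 * q₀) with hsmall | hlarge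
  -- One flip of the target itself suffices; h ≤ 16q₀ gives (2h)² ≤ 1024q₀², the source of the
  -- constant.
  · apply red 1
    · have : (h : ℝ) ≤ 16 * q₀ := by exact_mod_cast hsmall.le
      rw [div_mul_eq_mul_div, div_le_iff₀ (by positivity)]
      push_cast
      nlinarith
    · have hstep := sub_evolve_zero_le hn h0 h1 hmono (c := c) (s := 0) (k := 1) {i}
        (Finset.card_singleton i) (by
          intro r _ hr y hy j hj
          obtain rfl : r = 0 := by omega
          rw [Finset.mem_singleton] at hy
          subst hy
          simpa [evolve, occupied, hj] using hc1)
      have := evolve_zero_mono hn h0 h1 hmono (show 0 + 1 ≤ h by omega)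
      simp only at this
      have hz : evolve hn p (occupied i) 0 0 = 0 := by simp [evolve, occupied]
      rw [hz] at hstep
      simp only [one_mul, sub_zero] at hstep
      linarith
  · set q := h / 16 with hq
    obtain ⟨x, rfl⟩ := ZMod.intCast_surjective i
    have hqq : q₀ ≤ q := by omega
    let A : Finset (ZMod n) := (Finset.range q).image fun d : ℕ => ((x + d : ℤ) : ZMod n)
    have hA : A.card = q := by
      rw [Finset.card_image_of_injOn, Finset.card_range]
      intro a ha b hb hab
      simp only [Finset.coe_range, Set.mem_Iio] at ha hb
      simp only [Int.cast_add, add_right_inj, Int.cast_natCast] at hab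
      rw [ZMod.natCast_eq_natCast_iff'] at hab
      rwa [Nat.mod_eq_of_lt (by omega), Nat.mod_eq_of_lt (by omega)] at hab
    -- The window: q = ⌊h/16⌋ sites starting at x, and the rounds after which at least h - h/2
    -- layers remain. One layer creates a pair, and at least 4q layers are left for its growth.
    have hstep := sub_evolve_zero_le hn h0 h1 hmono (c := c) (s := h - h / 2) (k := h / 2) A hA (by
      intro r hr hr' y hy j hj
      obtain ⟨d, hd, rfl⟩ := Finset.mem_image.1 hy
      rw [Finset.mem_range] at hd
      obtain ⟨s, rfl⟩ : ∃ s, r = s + 1 := ⟨r - 1, by omega⟩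
      exact (hcq q hqq).trans (le_evolve_of_occupied hn h0 h1 x (by omega) (by omega) hd hj))
    rw [Nat.sub_add_cancel (by omega : h / 2 ≤ h)] at hstep
    apply red (q * (h / 2))
    · have e1 : (h : ℝ) ≤ 32 * (q : ℝ) := by exact_mod_cast (by omega : h ≤ 32 * q)
      have e2 : (h : ℝ) ≤ 3 * ((h / 2 : ℕ) : ℝ) := by exact_mod_cast (by omega : h ≤ 3 * (h / 2))
      have hh0 : (0 : ℝ) ≤ h := Nat.cast_nonneg h
      rw [div_mul_eq_mul_div, div_le_iff₀ (by positivity)]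
      push_cast
      have e3 : (h : ℝ) * h ≤ (32 * (q : ℝ)) * (3 * ((h / 2 : ℕ) : ℝ)) :=
        mul_le_mul e1 e2 hh0 (by positivity)
      have e4 : (1 : ℝ) ≤ (q₀ : ℝ) ^ 2 := one_le_pow₀ hq₀'
      have e5 : (0 : ℝ) ≤ (q : ℝ) * ((h / 2 : ℕ) : ℝ) := by positivity
      nlinarith [mul_le_mul_of_nonneg_left e4 e5]
    · refine hstep.trans (mul_le_mul_of_nonneg_left ?_ (pow_nonneg (by linarith) _))
      linarith [hpos (h - h / 2) 0]

end growth

/-! ### Unitarily covariant maps -/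

section covariant

open Matrix

variable {ι : Type*} [Fintype ι] [DecidableEq ι]

/-- The vector with entries `1` at `i` and `-2` at `j`. -/
def reflectionAxis (i j k : ι) : ℂ := (if k = i then 1 else 0) - 2 * if k = j then 1 else 0

/-- The reflection `[[3/5, 4/5], [4/5, -3/5]]` in the plane spanned by the basis vectors `i, j`;
it negates the vector `reflectionAxis i j`. -/
def planeReflection (i j : ι) : Matrix ι ι ℂ := fun k l =>
  (if k = l then 1 else 0) - 2 / 5 * reflectionAxis i j k * reflectionAxis i j l

lemma planeReflection_conjTranspose (i j : ι) : (planeReflection i j)ᴴ = planeReflection i j := by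
  ext k l
  simp only [conjTranspose_apply, planeReflection, reflectionAxis]
  simp only [star_sub, star_mul', apply_ite star, star_one, star_zero, star_div₀, star_ofNat,
    eq_comm (a := l) (b := k)]
  ring

lemma planeReflection_mul_apply (i j : ι) (X : Matrix ι ι ℂ) (k l : ι) :
    (planeReflection i j * X) k l =
      X k l - 2 / 5 * reflectionAxis i j k * (X i l - 2 * X j l) := by
  simp only [mul_apply, planeReflection, reflectionAxis, sub_mul, mul_sub, Finset.sum_sub_distrib]
  simp [mul_assoc]

lemma mul_planeReflection_apply (i j : ι) (X : Matrix ι ι ℂ) (k l : ι) :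
    (X * planeReflection i j) k l =
      X k l - 2 / 5 * reflectionAxis i j l * (X k i - 2 * X k j) := by
  have h := planeReflection_mul_apply i j Xᴴ l k
  have h' := congrArg star h
  rw [← conjTranspose_apply, conjTranspose_mul, conjTranspose_conjTranspose,
    planeReflection_conjTranspose] at h'
  rw [h']
  simp only [conjTranspose_apply, reflectionAxis, star_sub, star_mul', star_star, star_div₀,
    star_ofNat, apply_ite star, star_one, star_zero]

/-- The axis has squared length 1 + 4 = 5, whence the coefficient 2/5. The reflection is rational
with nonzero entries in its plane, so comparing entries needs no roots. -/
lemma planeReflection_mul_self {i j : ι} (hij : i ≠ j) :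
    planeReflection i j * planeReflection i j = 1 := by
  ext k l
  rw [planeReflection_mul_apply]
  simp only [planeReflection, one_apply]
  have e1 : reflectionAxis i j i = 1 := by simp [reflectionAxis, hij]
  have e2 : reflectionAxis i j j = -2 := by simp [reflectionAxis, hij.symm]
  have e3 : ((if i = l then 1 else 0) - 2 * if j = l then 1 else 0 : ℂ) = reflectionAxis i j l := by
    simp only [reflectionAxis, eq_comm]
  rw [e1, e2]
  linear_combination (-2 / 5 * reflectionAxis i j k) * e3

/-- A linear map commuting with all unitary conjugations is a combination of the identity and the
completely depolarizing map. -/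
theorem exists_eq_smul_add_trace_smul_one [Nontrivial ι] {E : Module.End ℂ (Matrix ι ι ℂ)}
    (hE : ∀ V : Matrix ι ι ℂ, Vᴴ * V = 1 → ∀ X, E (V * X * Vᴴ) = V * E X * Vᴴ) :
    ∃ α β : ℂ, ∀ X, E X = α • X + (β * X.trace) • (1 : Matrix ι ι ℂ) := by
  -- Covariance under the diagonal unitary with phase i at the basis vector q. A fourth root of
  -- unity is needed: signs alone cannot separate |i⟩⟨j| from |j⟩⟨i|.
  have hphase : ∀ (q i j k l : ι),
      (if i = q then Complex.I else 1) * (if j = q then -Complex.I else 1) *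
        E (single i j 1) k l =
      (if k = q then Complex.I else 1) * (if l = q then -Complex.I else 1) *
        E (single i j 1) k l := by
    intro q i j k l
    have h := hE (diagonal fun m => if m = q then Complex.I else 1) (by
      rw [diagonal_conjTranspose, diagonal_mul_diagonal, ← diagonal_one]
      congr 1
      funext m
      by_cases hm : m = q <;> simp [hm]) (single i j 1)
    have h1 : (diagonal fun m => if m = q then Complex.I else 1) * single i j (1 : ℂ) *
        (diagonal fun m => if m = q then Complex.I else 1)ᴴ =
        ((if i = q then Complex.I else 1) * (if j = q then -Complex.I else 1)) •
          single i j (1 : ℂ) := by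
      ext a b
      rw [diagonal_conjTranspose, mul_diagonal, diagonal_mul, Matrix.smul_apply]
      by_cases ha : i = a ∧ j = b
      · obtain ⟨rfl, rfl⟩ := ha
        by_cases hb : j = q <;> simp [hb]
      · simp [ha]
    rw [h1, map_smul] at h
    have h2 := congrFun (congrFun h k) l
    rw [diagonal_conjTranspose, mul_diagonal, diagonal_mul, Matrix.smul_apply, smul_eq_mul] at h2
    rw [h2, mul_right_comm]
    by_cases hl : l = q <;> simp [hl]
  have I1 : Complex.I ≠ 1 := fun h => by simpa using congrArg Complex.re h
  have I2 : Complex.I ≠ -Complex.I := fun h => by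
    have := congrArg Complex.im h; norm_num at this
  have I3 : -Complex.I ≠ 1 := fun h => by simpa using congrArg Complex.re h
  have hdiag : ∀ i k l : ι, k ≠ l → E (single i i 1) k l = 0 := by
    intro i k l hkl
    by_contra h0
    have h := mul_right_cancel₀ h0 (hphase k i i k l)
    by_cases hi : i = k
    · subst hi; simp [hkl.symm] at h; exact I1 h.symm
    · simp [hi, hkl.symm] at h; exact I1 h.symm
  have hoff : ∀ i j k l : ι, i ≠ j → (k ≠ i ∨ l ≠ j) → E (single i j 1) k l = 0 := by
    intro i j k l hij hkl
    by_contra h0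
    by_cases hki : k = i
    · subst hki
      have hlj : l ≠ j := by simpa using hkl
      have h := mul_right_cancel₀ h0 (hphase j k j k l)
      simp [hij, hlj] at h
      exact I3 h
    · have h := mul_right_cancel₀ h0 (hphase i i j k l)
      by_cases hl : l = i
      · simp [hij.symm, hki, hl] at h; exact I2 h
      · simp [hij.symm, hki, hl] at h; exact I1 h
  have hrefl : ∀ i j : ι, i ≠ j → ∀ X, E (planeReflection i j * X * planeReflection i j) =
      planeReflection i j * E X * planeReflection i j := by
    intro i j hij X
    have h := hE (planeReflection i j) (by
      rw [planeReflection_conjTranspose, planeReflection_mul_self hij]) X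
    rwa [planeReflection_conjTranspose] at h
  -- The reflection turns |i⟩⟨i| into a combination of the four matrix units of the plane. Comparing
  -- entries then yields the linear relations among the remaining coefficients.
  have hconj : ∀ i j : ι, i ≠ j →
      planeReflection i j * single i i (1 : ℂ) * planeReflection i j =
      (9 / 25 : ℂ) • single i i 1 + (12 / 25 : ℂ) • single i j 1 + (12 / 25 : ℂ) • single j i 1
        + (16 / 25 : ℂ) • single j j (1 : ℂ) := by
    intro i j hij
    ext k l
    simp only [mul_planeReflection_apply, planeReflection_mul_apply, Matrix.add_apply,
      Matrix.smul_apply, smul_eq_mul, single_apply, reflectionAxis, hij, and_true,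
      true_and, and_false, false_and, if_true, if_false, eq_comm (a := i), eq_comm (a := j)]
    by_cases hki : k = i <;> by_cases hkj : k = j <;> by_cases hli : l = i <;>
      by_cases hlj : l = j <;> simp [hki, hkj, hli, hlj, hij, hij.symm] <;> norm_num
  have hentry : ∀ i j : ι, i ≠ j → ∀ k l,
      9 / 25 * E (single i i 1) k l + 12 / 25 * E (single i j 1) k l +
        12 / 25 * E (single j i 1) k l + 16 / 25 * E (single j j 1) k l =
      (planeReflection i j * E (single i i 1) * planeReflection i j) k l := by
    intro i j hij k l
    rw [← hrefl i j hij, hconj i j hij]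
    simp only [map_add, map_smul, Matrix.add_apply, Matrix.smul_apply, smul_eq_mul]
  have hax : ∀ i j : ι, i ≠ j → reflectionAxis i j i = 1 ∧ reflectionAxis i j j = -2 :=
    fun i j hij => ⟨by simp [reflectionAxis, hij], by simp [reflectionAxis, hij.symm]⟩
  have hγ : ∀ i j : ι, i ≠ j → E (single i j 1) i j = E (single i i 1) i i - E (single i i 1) j j := by
    intro i j hij
    have h := hentry i j hij i j
    simp only [mul_planeReflection_apply, planeReflection_mul_apply, (hax i j hij).1,
      (hax i j hij).2, hdiag _ _ _ hij, hdiag _ _ _ hij.symm,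
      hoff j i i j hij.symm (Or.inl hij)] at h
    linear_combination 25 / 12 * h
  have hγ' : ∀ i j : ι, i ≠ j → E (single j i 1) j i = E (single i i 1) i i - E (single i i 1) j j := by
    intro i j hij
    have h := hentry i j hij j i
    simp only [mul_planeReflection_apply, planeReflection_mul_apply, (hax i j hij).1,
      (hax i j hij).2, hdiag _ _ _ hij, hdiag _ _ _ hij.symm,
      hoff i j j i hij (Or.inl hij.symm)] at h
    linear_combination 25 / 12 * h
  have hS : ∀ i j : ι, i ≠ j → E (single i i 1) j j = E (single j j 1) i i := by
    intro i j hij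
    have h := hentry i j hij i i
    simp only [mul_planeReflection_apply, planeReflection_mul_apply, (hax i j hij).1,
      hdiag _ _ _ hij, hdiag _ _ _ hij.symm,
      hoff i j i i hij (Or.inr hij), hoff j i i i hij.symm (Or.inl hij)] at h
    linear_combination -25 / 16 * h
  have hT : ∀ i j k : ι, k ≠ i → k ≠ j → E (single i i 1) k k = E (single j j 1) k k := by
    intro i j k hki hkj
    rcases eq_or_ne i j with rfl | hij
    · rfl
    have h := hentry i j hij k k
    have hk : reflectionAxis i j k = 0 := by simp [reflectionAxis, hki, hkj]
    simp only [mul_planeReflection_apply, planeReflection_mul_apply, hk,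
      hoff i j k k hij (Or.inl hki), hoff j i k k hij.symm (Or.inl hkj)] at h
    linear_combination -25 / 16 * h
  -- The coefficient of |j⟩⟨i| is computed from |i⟩⟨i| and from |j⟩⟨j|.
  have hD : ∀ i j : ι, E (single i i 1) i i = E (single j j 1) j j := by
    intro i j
    rcases eq_or_ne i j with rfl | hij
    · rfl
    linear_combination -hγ' i j hij + hγ j i hij.symm + hS i j hij
  have hB : ∀ i k i' k' : ι, i ≠ k → i' ≠ k' → E (single i i 1) k k = E (single i' i' 1) k' k' := by
    intro i k i' k' h h'
    rcases eq_or_ne k k' with rfl | hk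
    · exact hT _ _ _ h.symm h'.symm
    · rw [hT i k' k h.symm hk, hS k' k hk.symm, hT k i' k' hk.symm h'.symm]
  obtain ⟨i₀, j₀, h₀⟩ := exists_pair_ne ι
  refine ⟨E (single i₀ i₀ 1) i₀ i₀ - E (single i₀ i₀ 1) j₀ j₀, E (single i₀ i₀ 1) j₀ j₀, fun X => ?_⟩
  induction X using Matrix.induction_on' with
  | h_zero => simp
  | h_add X Y hX hY => rw [map_add, hX, hY, trace_add, mul_add, add_smul, smul_add]; abel
  | h_std_basis i j x =>
    have hx : single i j x = x • single i j (1 : ℂ) := by simp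
    rw [hx, map_smul, trace_smul, smul_comm, smul_eq_mul, mul_left_comm, mul_smul, ← smul_add]
    congr 1
    ext k l
    rw [Matrix.add_apply, Matrix.smul_apply, Matrix.smul_apply, smul_eq_mul, smul_eq_mul]
    rcases eq_or_ne i j with rfl | hij
    · rcases eq_or_ne k l with rfl | hkl
      · rcases eq_or_ne i k with rfl | hik
        · simp [hD i i₀]
        · simp [hB i k i₀ j₀ hik h₀, hik]
      · rw [hdiag i k l hkl]
        have : ¬ (i = k ∧ i = l) := fun h => hkl (h.1.symm.trans h.2)
        simp [this, hkl]
    · rw [trace_single_eq_of_ne i j _ hij]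
      by_cases h : k = i ∧ l = j
      · obtain ⟨rfl, rfl⟩ := h
        rw [hγ k l hij, hD k i₀, hB k l i₀ j₀ hij h₀]
        simp
      · rw [hoff i j k l hij (not_and_or.1 h)]
        have : ¬ (i = k ∧ j = l) := fun h' => h ⟨h'.1.symm, h'.2.symm⟩
        simp [this]

end covariant

/-! ### Averages of matrix-valued functions -/

section entryMean

variable {Ω a b c d : Type*} [MeasurableSpace Ω] {μ : Measure Ω}

/-- The entrywise integral of a matrix-valued function. -/
def entryMean (μ : Measure Ω) (F : Ω → Matrix a b ℂ) : Matrix a b ℂ :=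
  Matrix.of fun x y => ∫ ω, F ω x y ∂μ

lemma entryMean_apply (F : Ω → Matrix a b ℂ) (x : a) (y : b) :
    entryMean μ F x y = ∫ ω, F ω x y ∂μ := rfl

variable [Fintype a] [Fintype b] [DecidableEq a] [DecidableEq b]

lemma integral_linear_apply (l : Matrix a b ℂ →ₗ[ℂ] ℂ) {F : Ω → Matrix a b ℂ}
    (hF : ∀ x y, Integrable (fun ω => F ω x y) μ) :
    ∫ ω, l (F ω) ∂μ = l (entryMean μ F) := by
  have h : ∀ X : Matrix a b ℂ, l X = ∑ x, ∑ y, X x y * l (Matrix.single x y 1) := by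
    intro X
    conv_lhs => rw [Matrix.matrix_eq_sum_single X]
    simp only [map_sum]
    refine Finset.sum_congr rfl fun x _ => Finset.sum_congr rfl fun y _ => ?_
    rw [← smul_eq_mul, ← map_smul]
    simp
  simp only [h (F _), h (entryMean μ F), entryMean_apply]
  rw [integral_finsetSum _ fun x _ => integrable_finsetSum _ fun y _ => (hF x y).mul_const _]
  refine Finset.sum_congr rfl fun x _ => ?_
  rw [integral_finsetSum _ fun y _ => (hF x y).mul_const _]
  exact Finset.sum_congr rfl fun y _ => integral_mul_const _ _

lemma entryMean_linear (L : Matrix a b ℂ →ₗ[ℂ] Matrix c d ℂ) {F : Ω → Matrix a b ℂ}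
    (hF : ∀ x y, Integrable (fun ω => F ω x y) μ) :
    entryMean μ (fun ω => L (F ω)) = L (entryMean μ F) := by
  ext x y
  exact integral_linear_apply ((Matrix.entryLinearMap ℂ ℂ x y).comp L) hF

end entryMean

/-! ### Twirling over a two-qubit gate -/

section twirl

open Matrix

instance : haarGate.IsHaarMeasure := by
  unfold haarGate; infer_instance

/-- Makes open sets measurable for the product σ-algebra on families of gates, so that continuous
functions of them are integrable. -/
instance : SecondCountableTopology Gate := by
  have : SecondCountableTopology (Matrix (Fin 2 × Fin 2) (Fin 2 × Fin 2) ℂ) :=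
    inferInstanceAs (SecondCountableTopology (Fin 2 × Fin 2 → Fin 2 × Fin 2 → ℂ))
  exact TopologicalSpace.Subtype.secondCountableTopology _

/-- A right translate is again a Haar probability measure, so uniqueness identifies it with the
original. -/
instance : haarGate.IsMulRightInvariant := by
  refine ⟨fun g => ?_⟩
  have : IsProbabilityMeasure (haarGate.map (· * g)) :=
    Measure.isProbabilityMeasure_map (measurable_mul_const g).aemeasurable
  exact Measure.isHaarMeasure_eq_of_isProbabilityMeasure _ _

lemma integrable_of_continuous {X : Type*} [TopologicalSpace X] [CompactSpace X]
    [MeasurableSpace X] [OpensMeasurableSpace X] {μ : Measure X} [IsFiniteMeasure μ] {f : X → ℂ}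
    (hf : Continuous f) : Integrable f μ :=
  hf.integrable_of_hasCompactSupport (HasCompactSupport.of_compactSpace f)

/-- Operators on two qubits. -/
abbrev PairOp : Type := Matrix (Fin 2 × Fin 2) (Fin 2 × Fin 2) ℂ

/-- The tensor product of two single-qubit maps. -/
def pairMap (A B : Module.End ℂ QubitOp) : Module.End ℂ PairOp where
  toFun ρ := Matrix.of fun x y => ∑ x', ∑ y',
    (A (single x'.1 y'.1 1) x.1 y.1 * B (single x'.2 y'.2 1) x.2 y.2) * ρ x' y'
  map_add' ρ σ := by
    ext x y
    simp [mul_add, Finset.sum_add_distrib]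
  map_smul' a ρ := by
    ext x y
    simp [Finset.mul_sum, mul_left_comm]

lemma pairMap_apply (A B : Module.End ℂ QubitOp) (ρ : PairOp) (x y : Fin 2 × Fin 2) :
    pairMap A B ρ x y = ∑ x', ∑ y',
      (A (single x'.1 y'.1 1) x.1 y.1 * B (single x'.2 y'.2 1) x.2 y.2) * ρ x' y' := rfl

lemma tau_zero_apply (X : QubitOp) : tau 0 X = X := by simp [tau]

lemma tau_one_apply (X : QubitOp) : tau 1 X = (X.trace / 2) • (1 : QubitOp) := by
  simp [tau, smul_smul, div_eq_mul_inv]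

lemma pairMap_tau_zero (X : PairOp) : pairMap (tau 0) (tau 0) X = X := by
  ext x y
  rw [pairMap_apply, Fintype.sum_eq_single x, Fintype.sum_eq_single y]
  · simp [tau_zero_apply]
  · intro y' h
    rw [Ne, Prod.ext_iff, not_and_or] at h
    rcases h with h | h <;> simp [tau_zero_apply, single_apply, h]
  · intro x' h
    rw [Ne, Prod.ext_iff, not_and_or] at h
    refine Finset.sum_eq_zero fun y' _ => ?_
    rcases h with h | h <;> simp [tau_zero_apply, single_apply, h]

lemma pairMap_tau_one (X : PairOp) :
    pairMap (tau 1) (tau 1) X = (X.trace / 4) • (1 : PairOp) := by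
  ext x y
  rw [pairMap_apply]
  simp only [tau_one_apply, Fintype.sum_prod_type, Fin.sum_univ_two, trace, diag_apply,
    single_apply, Matrix.smul_apply, one_apply, smul_eq_mul, Prod.ext_iff]
  by_cases h1 : x.1 = y.1 <;> by_cases h2 : x.2 = y.2 <;> simp [h1, h2]
  ring

lemma trace_pairMap_tau (a b : Fin 2) (X : PairOp) :
    (pairMap (tau a) (tau b) X).trace = X.trace := by
  have hτ : ∀ (a x y : Fin 2), (tau a (single x y 1)) 0 0 + (tau a (single x y 1)) 1 1 =
      if x = y then 1 else 0 := by
    intro a x y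
    fin_cases a <;> fin_cases x <;> fin_cases y <;>
      simp [tau_zero_apply, tau_one_apply] <;> norm_num
  have h : (pairMap (tau a) (tau b) X).trace = ∑ x' : Fin 2 × Fin 2, ∑ y' : Fin 2 × Fin 2,
      ((tau a (single x'.1 y'.1 1) 0 0 + tau a (single x'.1 y'.1 1) 1 1) *
        (tau b (single x'.2 y'.2 1) 0 0 + tau b (single x'.2 y'.2 1) 1 1)) * X x' y' := by
    simp only [trace, diag_apply, pairMap_apply, Fintype.sum_prod_type, Fin.sum_univ_two]
    ring
  rw [h]
  simp only [hτ, Fintype.sum_prod_type, Fin.sum_univ_two, trace, diag_apply]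
  simp

lemma trace_end (L : Module.End ℂ PairOp) :
    LinearMap.trace ℂ PairOp L = ∑ x, ∑ y, L (single x y 1) x y := by
  rw [LinearMap.trace_eq_matrix_trace ℂ (Matrix.stdBasis ℂ (Fin 2 × Fin 2) (Fin 2 × Fin 2)),
    trace, ← Finset.univ_product_univ, Finset.sum_product]
  refine Finset.sum_congr rfl fun x _ => Finset.sum_congr rfl fun y _ => ?_
  rw [diag_apply, LinearMap.toMatrix_apply, Matrix.stdBasis_eq_single]
  rfl

/-- Conjugation by an operator. -/
def gateConj (U : PairOp) : Module.End ℂ PairOp where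
  toFun X := U * X * Uᴴ
  map_add' X Y := by rw [mul_add, add_mul]
  map_smul' a X := by simp

lemma gateConj_apply (U X : PairOp) : gateConj U X = U * X * Uᴴ := rfl

lemma gate_star_mul (U : Gate) : (U : PairOp)ᴴ * (U : PairOp) = 1 :=
  (mem_unitaryGroup_iff'.1 U.2)

lemma gate_mul_star (U : Gate) : (U : PairOp) * (U : PairOp)ᴴ = 1 :=
  (mem_unitaryGroup_iff.1 U.2)

/-- The map `X ↦ U† M(U X U†) U`. -/
def gateTwist (M : Module.End ℂ PairOp) (U : PairOp) : Module.End ℂ PairOp :=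
  gateConj Uᴴ ∘ₗ M ∘ₗ gateConj U

lemma gateTwist_apply (M : Module.End ℂ PairOp) (U X : PairOp) :
    gateTwist M U X = Uᴴ * M (U * X * Uᴴ) * U := by
  simp [gateTwist, gateConj_apply]

lemma continuous_gateTwist (M : Module.End ℂ PairOp) (X : PairOp) :
    Continuous fun U : Gate => gateTwist M U X := by
  simp only [gateTwist_apply]
  have hM : Continuous M := LinearMap.continuous_of_finiteDimensional M
  have hU : Continuous fun U : Gate => (U : PairOp) := continuous_subtype_val
  exact (hU.matrix_conjTranspose.matrix_mul (hM.comp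
    ((hU.matrix_mul continuous_const).matrix_mul hU.matrix_conjTranspose))).matrix_mul hU

lemma integrable_gateTwist (M : Module.End ℂ PairOp) (X : PairOp) (x y : Fin 2 × Fin 2) :
    Integrable (fun U : Gate => gateTwist M U X x y) haarGate :=
  integrable_of_continuous ((continuous_gateTwist M X).matrix_elem x y)

/-- The Haar average of `X ↦ U† M(U X U†) U`. -/
def gateTwirl (M : Module.End ℂ PairOp) : Module.End ℂ PairOp where
  toFun X := entryMean haarGate fun U => gateTwist M U X
  map_add' X Y := by
    ext x y
    simp only [map_add, Matrix.add_apply, entryMean_apply]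
    exact integral_add (integrable_gateTwist M X x y) (integrable_gateTwist M Y x y)
  map_smul' c X := by
    ext x y
    simp only [map_smul, Matrix.smul_apply, entryMean_apply, smul_eq_mul, RingHom.id_apply]
    exact integral_const_mul c _

lemma gateTwirl_apply (M : Module.End ℂ PairOp) (X : PairOp) :
    gateTwirl M X = entryMean haarGate fun U => gateTwist M U X := rfl

/-- The twist by U of V X V† is V(·)V† applied to the twist by UV of X; right invariance absorbs V.
-/
lemma gateTwirl_covariant (M : Module.End ℂ PairOp) {V : PairOp} (hV : Vᴴ * V = 1) (X : PairOp) :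
    gateTwirl M (V * X * Vᴴ) = V * gateTwirl M X * Vᴴ := by
  let V' : Gate := ⟨V, mem_unitaryGroup_iff'.2 hV⟩
  have hV' : V * Vᴴ = 1 := gate_mul_star V'
  have h1 : ∀ U : Gate, gateTwist M U (V * X * Vᴴ) =
      gateConj V (gateTwist M ((U * V' : Gate) : PairOp) X) := by
    intro U
    have : ((U * V' : Gate) : PairOp) = U * V := rfl
    rw [gateConj_apply, gateTwist_apply, gateTwist_apply, this, conjTranspose_mul]
    simp only [← mul_assoc, hV', one_mul]
    rw [mul_assoc _ V Vᴴ, hV', mul_one]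
  rw [← gateConj_apply V (gateTwirl M X), gateTwirl_apply, gateTwirl_apply,
    ← entryMean_linear (gateConj V) (integrable_gateTwist M X)]
  ext x y
  simp only [entryMean_apply, h1]
  exact integral_mul_right_eq_self (fun U : Gate => gateConj V (gateTwist M U X) x y) V'

lemma trace_gateTwirl {M : Module.End ℂ PairOp} (hM : ∀ X, (M X).trace = X.trace) (X : PairOp) :
    (gateTwirl M X).trace = X.trace := by
  have h := integral_linear_apply (μ := haarGate) (Matrix.traceLinearMap (Fin 2 × Fin 2) ℂ ℂ)
    (integrable_gateTwist M X)
  have h1 : ∀ U : Gate, (gateTwist M U X).trace = X.trace := by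
    intro U
    rw [gateTwist_apply, trace_mul_comm, ← mul_assoc, gate_mul_star, one_mul, hM, trace_mul_comm,
      ← mul_assoc, gate_star_mul, one_mul]
  simp only [traceLinearMap_apply, h1, integral_const, probReal_univ, one_smul] at h
  rw [gateTwirl_apply, ← h]

/-- For each U the twist is similar to M as a superoperator, so its trace does not depend on U. -/
lemma trace_end_gateTwirl (M : Module.End ℂ PairOp) :
    LinearMap.trace ℂ PairOp (gateTwirl M) = LinearMap.trace ℂ PairOp M := by
  have h1 : ∀ U : Gate, ∑ x, ∑ y, gateTwist M U (single x y 1) x y =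
      LinearMap.trace ℂ PairOp M := by
    intro U
    have hid : gateConj (U : PairOp) * gateConj (U : PairOp)ᴴ = 1 := by
      ext1 X
      simp only [Module.End.mul_apply, gateConj_apply, conjTranspose_conjTranspose,
        Module.End.one_apply]
      rw [← mul_assoc, ← mul_assoc, gate_mul_star, one_mul, mul_assoc, gate_mul_star, mul_one]
    rw [← trace_end]
    change LinearMap.trace ℂ PairOp (gateConj (U : PairOp)ᴴ * (M * gateConj (U : PairOp))) = _
    rw [LinearMap.trace_mul_comm, mul_assoc, hid, mul_one]
  rw [trace_end]
  simp only [gateTwirl_apply, entryMean_apply]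
  have h2 := integral_congr_ae (μ := haarGate) (Filter.Eventually.of_forall h1)
  rw [integral_finsetSum _ fun x _ => integrable_finsetSum _ fun y _ =>
    integrable_gateTwist M _ x y] at h2
  rw [integral_const, probReal_univ, one_smul] at h2
  rw [← h2]
  refine Finset.sum_congr rfl fun x _ => ?_
  rw [integral_finsetSum _ fun y _ => integrable_gateTwist M _ x y]

/-- Twirling a product of `τ` maps on two qubits replaces both indices by their maximum with
probability `4 / 5` and by their minimum with probability `1 / 5`. -/
theorem gateTwirl_pairMap_tau (a b : Fin 2) (X : PairOp) :
    gateTwirl (pairMap (tau a) (tau b)) X =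
      ∑ c : Bool, (coinWeight c : ℂ) •
        pairMap (tau (if c then max a b else min a b)) (tau (if c then max a b else min a b)) X := by
  set M := pairMap (tau a) (tau b) with hM
  obtain ⟨α, β, h⟩ := exists_eq_smul_add_trace_smul_one fun V hV X =>
    gateTwirl_covariant M hV X
  have h1 : α + 4 * β = 1 := by
    have := trace_gateTwirl (trace_pairMap_tau a b) (single 0 0 1)
    rw [← hM, h] at this
    simp at this
    linear_combination this
  -- The second equation for α and β: the identity has superoperator trace 16 and X ↦ tr(X)I has 4,
  -- while τ₀ has 4 and τ₁ has 1 on a single qubit.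
  have h2 := trace_end_gateTwirl M
  rw [trace_end, trace_end] at h2
  simp only [h] at h2
  have h3 : ∑ x : Fin 2 × Fin 2, ∑ y : Fin 2 × Fin 2,
      (α • single x y (1 : ℂ) + (β * (single x y (1 : ℂ)).trace) • (1 : PairOp)) x y =
      16 * α + 4 * β := by
    have : ∀ x y : Fin 2 × Fin 2,
        (α • single x y (1 : ℂ) + (β * (single x y (1 : ℂ)).trace) • (1 : PairOp)) x y =
        α + if x = y then β else 0 := by
      intro x y
      rcases eq_or_ne x y with rfl | hxy
      · simp
      · simp [hxy]
    simp only [this]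
    simp [Finset.sum_add_distrib]
    ring
  rw [h3] at h2
  have h4 : ∑ x : Fin 2 × Fin 2, ∑ y : Fin 2 × Fin 2, M (single x y 1) x y =
      (if a = 0 then 4 else 1) * (if b = 0 then 4 else 1) := by
    have : ∀ x y, M (single x y 1) x y =
        tau a (single x.1 y.1 1) x.1 y.1 * tau b (single x.2 y.2 1) x.2 y.2 := by
      intro x y
      rw [hM, pairMap_apply, Fintype.sum_eq_single x, Fintype.sum_eq_single y]
      · simp
      · intro y' hy; simp [hy.symm]
      · intro x' hx; simp [hx.symm]
    simp only [this, Fintype.sum_prod_type, Fin.sum_univ_two]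
    fin_cases a <;> fin_cases b <;>
      simp [tau_zero_apply, tau_one_apply] <;> norm_num
  rw [h4] at h2
  rw [h]
  fin_cases a <;> fin_cases b <;>
    simp [pairMap_tau_zero, pairMap_tau_one, coinWeight] at h2 ⊢
  · obtain rfl : α = 1 := by linear_combination (h2 - h1) / 15
    obtain rfl : β = 0 := by linear_combination h1 / 4
    module
  · obtain rfl : α = 1 / 5 := by linear_combination (h2 - h1) / 15
    obtain rfl : β = 1 / 5 := by linear_combination h1 / 4
    module
  · obtain rfl : α = 1 / 5 := by linear_combination (h2 - h1) / 15
    obtain rfl : β = 1 / 5 := by linear_combination h1 / 4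
    module
  · obtain rfl : α = 0 := by linear_combination (h2 - h1) / 15
    obtain rfl : β = 1 / 4 := by linear_combination h1 / 4
    module

end twirl

section layers

open Matrix

variable {n : ℕ} [NeZero n]

/-! ### Tensor products of single-qubit maps -/

lemma end_apply_eq_sum (E : Module.End ℂ QubitOp) (X : QubitOp) (x y : Fin 2) :
    E X x y = ∑ a, ∑ b, E (single a b 1) x y * X a b := by
  conv_lhs => rw [Matrix.matrix_eq_sum_single X]
  simp only [map_sum, Matrix.sum_apply]
  refine Finset.sum_congr rfl fun a _ => Finset.sum_congr rfl fun b _ => ?_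
  have : single a b (X a b) = X a b • single a b (1 : ℂ) := by simp
  rw [this, map_smul, Matrix.smul_apply, smul_eq_mul, mul_comm]

lemma tensorMap_apply (E : ZMod n → Module.End ℂ QubitOp) (ρ : Op n) (x y : ZMod n → Fin 2) :
    tensorMap E ρ x y = ∑ x' : ZMod n → Fin 2, ∑ y' : ZMod n → Fin 2,
      (∏ i, E i (single (x' i) (y' i) 1) (x i) (y i)) * ρ x' y' := rfl

lemma sum_sum_pi_prod {ι κ R : Type*} [Fintype ι] [DecidableEq ι] [Fintype κ] [CommSemiring R]
    (f : ι → κ → κ → R) :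
    ∑ x : ι → κ, ∑ y : ι → κ, ∏ i, f i (x i) (y i) = ∏ i, ∑ a, ∑ b, f i a b := by
  simp only [← sum_pi_prod fun i a => ∑ b, f i a b]
  exact Finset.sum_congr rfl fun x _ => sum_pi_prod fun i b => f i (x i) b

lemma tensorMap_tensorMap (E E' : ZMod n → Module.End ℂ QubitOp) (ρ : Op n) :
    tensorMap E (tensorMap E' ρ) = tensorMap (fun i => E i ∘ₗ E' i) ρ := by
  ext x y
  simp only [tensorMap_apply, LinearMap.comp_apply]
  have h : ∀ x'' y'' : ZMod n → Fin 2,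
      ∏ i, E i (E' i (single (x'' i) (y'' i) 1)) (x i) (y i) =
      ∑ x' : ZMod n → Fin 2, ∑ y' : ZMod n → Fin 2,
        ∏ i, (E i (single (x' i) (y' i) 1) (x i) (y i) *
          E' i (single (x'' i) (y'' i) 1) (x' i) (y' i)) := by
    intro x'' y''
    rw [sum_sum_pi_prod fun i a b => E i (single a b 1) (x i) (y i) *
      E' i (single (x'' i) (y'' i) 1) a b]
    exact Finset.prod_congr rfl fun i _ => end_apply_eq_sum _ _ _ _
  simp only [h, Finset.mul_sum, Finset.sum_mul, Finset.prod_mul_distrib]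
  have hc : ∀ f : (ZMod n → Fin 2) → (ZMod n → Fin 2) → (ZMod n → Fin 2) → (ZMod n → Fin 2) → ℂ,
      ∑ a, ∑ b, ∑ c, ∑ d, f a b c d = ∑ c, ∑ d, ∑ a, ∑ b, f a b c d := by
    intro f
    have h := Finset.sum_comm (s := Finset.univ) (t := Finset.univ)
      (f := fun p q : (ZMod n → Fin 2) × (ZMod n → Fin 2) => f p.1 p.2 q.1 q.2)
    simpa only [Fintype.sum_prod_type] using h
  rw [hc]
  refine Finset.sum_congr rfl fun _ _ => Finset.sum_congr rfl fun _ _ =>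
    Finset.sum_congr rfl fun _ _ => Finset.sum_congr rfl fun _ _ => ?_
  ring

lemma tensorMap_sum_smul {κ : Type*} [Fintype κ] (c : κ → ℝ)
    (E : ZMod n → κ → Module.End ℂ QubitOp) (ρ : Op n) :
    tensorMap (fun i => ∑ a, c a • E i a) ρ =
      ∑ η : ZMod n → κ, (∏ i, c (η i)) • tensorMap (fun i => E i (η i)) ρ := by
  ext x y
  simp only [Matrix.sum_apply, Matrix.smul_apply, tensorMap_apply, LinearMap.sum_apply,
    LinearMap.smul_apply]
  simp only [Complex.real_smul]
  have h : ∀ x' y' : ZMod n → Fin 2,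
      ∏ i, ∑ a, (c a : ℂ) * E i a (single (x' i) (y' i) 1) (x i) (y i) =
      ∑ η : ZMod n → κ, ∏ i, ((c (η i) : ℂ) * E i (η i) (single (x' i) (y' i) 1) (x i) (y i)) :=
    fun x' y' => (sum_pi_prod fun i a => (c a : ℂ) * E i a (single (x' i) (y' i) 1) (x i) (y i)).symm
  simp only [h, Finset.sum_mul, Finset.mul_sum, Finset.prod_mul_distrib]
  rw [(Finset.sum_congr rfl fun x' _ => Finset.sum_comm).trans Finset.sum_comm]
  refine Finset.sum_congr rfl fun _ _ => Finset.sum_congr rfl fun _ _ =>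
    Finset.sum_congr rfl fun _ _ => ?_
  rw [Complex.ofReal_prod]
  ring

/-- Noise is a random τ_b, and τ_b τ_a = τ_{a ⊔ b}: a depolarized qubit stays depolarized. -/
lemma depolarizing_comp_tau (p : ℝ) (a : Fin 2) :
    depolarizing p ∘ₗ tau a = ∑ b, flipWeight p b • tau (a ⊔ b) := by
  ext X k l
  fin_cases a
  · simp [depolarizing, flipWeight, tau_zero_apply, tau_one_apply]
  · simp [depolarizing, flipWeight, tau_zero_apply, tau_one_apply]
    ring

lemma tau_comp_depolarizing (p : ℝ) (a : Fin 2) :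
    tau a ∘ₗ depolarizing p = ∑ b, flipWeight p b • tau (a ⊔ b) := by
  ext X k l
  fin_cases a
  · simp [depolarizing, flipWeight, tau_zero_apply, tau_one_apply]
  · simp [depolarizing, flipWeight, tau_zero_apply, tau_one_apply]
    ring

lemma noise_tensorMap_tau (p : ℝ) (j : ZMod n → Fin 2) (ρ : Op n) :
    noise n p (tensorMap (fun i => tau (j i)) ρ) =
      ∑ η : ZMod n → Fin 2, (∏ i, flipWeight p (η i)) •
        tensorMap (fun i => tau ((j ⊔ η) i)) ρ := by
  rw [noise, tensorMap_tensorMap]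
  simp only [depolarizing_comp_tau]
  exact tensorMap_sum_smul _ (fun i b => tau (j i ⊔ b)) ρ

lemma tensorMap_tau_noise (p : ℝ) (j : ZMod n → Fin 2) (ρ : Op n) :
    tensorMap (fun i => tau (j i)) (noise n p ρ) =
      ∑ η : ZMod n → Fin 2, (∏ i, flipWeight p (η i)) •
        tensorMap (fun i => tau ((j ⊔ η) i)) ρ := by
  rw [noise, tensorMap_tensorMap]
  simp only [tau_comp_depolarizing]
  exact tensorMap_sum_smul _ (fun i b => tau (j i ⊔ b)) ρ

/-! ### Tensor products over the bonds of a layer -/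

/-- The configuration seen by the bonds of layer `s`. -/
def pairs (s : ℕ) (x : ZMod n → Fin 2) (k : Fin (n / 2)) : Fin 2 × Fin 2 :=
  (x (pairSite s k 0), x (pairSite s k 1))

lemma pairs_bijective (hn : Even n) (s : ℕ) :
    Function.Bijective (pairs s : (ZMod n → Fin 2) → Fin (n / 2) → Fin 2 × Fin 2) := by
  constructor
  · intro x y h
    funext i
    obtain ⟨⟨k, b⟩, rfl⟩ := (pairEquiv hn s).surjective i
    have hk := congrFun h k
    simp only [pairs, Prod.mk.injEq] at hk
    fin_cases b
    · exact hk.1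
    · exact hk.2
  · intro w
    refine ⟨fun i => if ((pairEquiv hn s).symm i).2 = 0 then (w ((pairEquiv hn s).symm i).1).1
      else (w ((pairEquiv hn s).symm i).1).2, ?_⟩
    funext k
    simp [pairs]

lemma sum_prod_pairs {R : Type*} [CommSemiring R] (hn : Even n) (s : ℕ)
    (f : Fin (n / 2) → Fin 2 × Fin 2 → R) :
    ∑ x : ZMod n → Fin 2, ∏ k, f k (pairs s x k) = ∏ k, ∑ a, f k a := by
  rw [← sum_pi_prod]
  exact (pairs_bijective hn s).sum_comp fun w => ∏ k, f k (w k)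

lemma prod_sites {R : Type*} [CommMonoid R] (hn : Even n) (s : ℕ) (g : ZMod n → R) :
    ∏ i, g i = ∏ k, (g (pairSite s k 0) * g (pairSite s k 1)) := by
  rw [← (pairEquiv hn s).prod_comp, Fintype.prod_prod_type]
  simp

/-- The tensor product of two-qubit operators placed on the bonds of layer `s`. -/
def pairTensor (s : ℕ) (X : Fin (n / 2) → PairOp) : Op n :=
  Matrix.of fun x y => ∏ k, X k (pairs s x k) (pairs s y k)

lemma pairTensor_apply (s : ℕ) (X : Fin (n / 2) → PairOp) (x y : ZMod n → Fin 2) :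
    pairTensor s X x y = ∏ k, X k (pairs s x k) (pairs s y k) := rfl

lemma brickLayer_eq_pairTensor (s : ℕ) (V : Fin (n / 2) → Gate) :
    brickLayer s V = pairTensor s fun k => (V k : PairOp) := rfl

lemma pairTensor_mul (hn : Even n) (s : ℕ) (X Y : Fin (n / 2) → PairOp) :
    pairTensor s X * pairTensor s Y = pairTensor s fun k => X k * Y k := by
  ext x y
  simp only [mul_apply, pairTensor_apply, ← Finset.prod_mul_distrib]
  exact sum_prod_pairs hn s fun k a => X k (pairs s x k) a * Y k a (pairs s y k)

lemma pairTensor_conjTranspose (s : ℕ) (X : Fin (n / 2) → PairOp) :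
    (pairTensor s X)ᴴ = pairTensor s fun k => (X k)ᴴ := by
  ext x y
  simp [pairTensor_apply, conjTranspose_apply]

/-- Matrix units factor over the bonds of any layer, so a linear identity need only be checked on
such products. -/
lemma single_eq_pairTensor (hn : Even n) (s : ℕ) (x y : ZMod n → Fin 2) :
    (single x y 1 : Op n) = pairTensor s fun k => single (pairs s x k) (pairs s y k) 1 := by
  ext a b
  rw [pairTensor_apply, single_apply]
  split_ifs with h
  · simp [h.1, h.2]
  · symm
    rcases not_and_or.1 h with h | h
    · obtain ⟨k, hk⟩ := Function.ne_iff.1 ((pairs_bijective hn s).1.ne h)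
      exact Finset.prod_eq_zero (Finset.mem_univ k) (by simp [hk])
    · obtain ⟨k, hk⟩ := Function.ne_iff.1 ((pairs_bijective hn s).1.ne h)
      exact Finset.prod_eq_zero (Finset.mem_univ k) (by simp [hk])

lemma tensorMap_pairTensor (hn : Even n) (s : ℕ) (E : ZMod n → Module.End ℂ QubitOp)
    (X : Fin (n / 2) → PairOp) :
    tensorMap E (pairTensor s X) =
      pairTensor s fun k => pairMap (E (pairSite s k 0)) (E (pairSite s k 1)) (X k) := by
  ext x y
  rw [tensorMap_apply, pairTensor_apply]
  simp only [pairTensor_apply]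
  have h1 : ∀ x' y' : ZMod n → Fin 2,
      (∏ i, E i (single (x' i) (y' i) 1) (x i) (y i)) *
        ∏ k, X k (pairs s x' k) (pairs s y' k) =
      ∏ k, (E (pairSite s k 0) (single (pairs s x' k).1 (pairs s y' k).1 1)
          (pairs s x k).1 (pairs s y k).1 *
        E (pairSite s k 1) (single (pairs s x' k).2 (pairs s y' k).2 1)
          (pairs s x k).2 (pairs s y k).2) * X k (pairs s x' k) (pairs s y' k) := by
    intro x' y'
    rw [prod_sites hn s, ← Finset.prod_mul_distrib]
    rfl
  simp only [h1]
  rw [Finset.sum_congr rfl fun x' _ => sum_prod_pairs hn s fun k b =>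
    (E (pairSite s k 0) (single (pairs s x' k).1 b.1 1) (pairs s x k).1 (pairs s y k).1 *
        E (pairSite s k 1) (single (pairs s x' k).2 b.2 1) (pairs s x k).2 (pairs s y k).2) *
          X k (pairs s x' k) b]
  exact sum_prod_pairs hn s fun k a => ∑ b,
    (E (pairSite s k 0) (single a.1 b.1 1) (pairs s x k).1 (pairs s y k).1 *
        E (pairSite s k 1) (single a.2 b.2 1) (pairs s x k).2 (pairs s y k).2) * X k a b

/-! ### Twirling over a layer -/

lemma conjBy_apply (U ρ : Op n) : conjBy U ρ = U * ρ * Uᴴ := rfl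

/-- The map `ρ ↦ U† M(U ρ U†) U` for the layer `U` built from the gates `V`. -/
def layerTwist (s : ℕ) (M : Module.End ℂ (Op n)) (V : Fin (n / 2) → Gate) :
    Module.End ℂ (Op n) :=
  conjBy (brickLayer s V)ᴴ ∘ₗ M ∘ₗ conjBy (brickLayer s V)

lemma layerTwist_apply (s : ℕ) (M : Module.End ℂ (Op n)) (V : Fin (n / 2) → Gate) (ρ : Op n) :
    layerTwist s M V ρ = conjBy (brickLayer s V)ᴴ (M (conjBy (brickLayer s V) ρ)) := rfl

/-- On a matrix unit the twist factors over the bonds, each factor involving only its own gate; the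
average will split accordingly. -/
lemma layerTwist_tensorMap_single (hn : Even n) (s : ℕ) (E : ZMod n → Module.End ℂ QubitOp)
    (V : Fin (n / 2) → Gate) (x y : ZMod n → Fin 2) :
    layerTwist s (tensorMap E) V (single x y 1) = pairTensor s fun k =>
      gateTwist (pairMap (E (pairSite s k 0)) (E (pairSite s k 1))) (V k)
        (single (pairs s x k) (pairs s y k) 1) := by
  simp only [layerTwist, LinearMap.comp_apply, conjBy_apply, brickLayer_eq_pairTensor,
    single_eq_pairTensor hn s x y, pairTensor_conjTranspose, pairTensor_mul hn,
    tensorMap_pairTensor hn, conjTranspose_conjTranspose, gateTwist_apply]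

lemma continuous_brickLayer (s : ℕ) :
    Continuous fun V : Fin (n / 2) → Gate => (brickLayer s V : Op n) := by
  refine continuous_matrix fun x y => ?_
  simp only [brickLayer_eq_pairTensor, pairTensor_apply]
  refine continuous_finsetProd _ fun k _ => ?_
  exact (continuous_subtype_val.comp (continuous_apply k)).matrix_elem _ _

lemma continuous_conjBy {X : Type*} [TopologicalSpace X] {U ρ : X → Op n} (hU : Continuous U)
    (hρ : Continuous ρ) : Continuous fun x => conjBy (U x) (ρ x) := by
  simp only [conjBy_apply]
  exact (hU.matrix_mul hρ).matrix_mul hU.matrix_conjTranspose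

lemma continuous_layerTwist (s : ℕ) (M : Module.End ℂ (Op n)) (ρ : Op n) :
    Continuous fun V => layerTwist s M V ρ := by
  have hM : Continuous M := LinearMap.continuous_of_finiteDimensional M
  have h1 : Continuous fun V : Fin (n / 2) → Gate => conjBy (brickLayer s V) ρ :=
    continuous_conjBy (continuous_brickLayer s) continuous_const
  have h2 : Continuous fun V : Fin (n / 2) → Gate => M (conjBy (brickLayer s V) ρ) := hM.comp h1
  have h3 : Continuous fun V : Fin (n / 2) → Gate => (brickLayer s V : Op n)ᴴ :=
    (continuous_brickLayer s).matrix_conjTranspose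
  simp only [layerTwist_apply]
  exact continuous_conjBy h3 h2

lemma integrable_layerTwist (s : ℕ) (M : Module.End ℂ (Op n)) (ρ : Op n) (x y : ZMod n → Fin 2) :
    Integrable (fun V => layerTwist s M V ρ x y) (Measure.pi fun _ => haarGate) :=
  integrable_of_continuous ((continuous_layerTwist s M ρ).matrix_elem x y)

/-- Averaging a layer merges the pairs of sites of its bonds. -/
theorem entryMean_layerTwist_tensorMap_tau (hn : Even n) (s : ℕ) (j : ZMod n → Fin 2) (ρ : Op n) :
    entryMean (Measure.pi fun _ => haarGate)
        (fun V => layerTwist s (tensorMap fun i => tau (j i)) V ρ) =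
      ∑ ω : Fin (n / 2) → Bool, (∏ k, coinWeight (ω k)) •
        tensorMap (fun i => tau (merge hn s ω j i)) ρ := by
  induction ρ using Matrix.induction_on' with
  | h_zero =>
    ext x y
    simp [entryMean_apply]
  | h_add ρ σ hρ hσ =>
    simp only [map_add, smul_add, Finset.sum_add_distrib]
    rw [← hρ, ← hσ]
    ext x y
    exact integral_add (integrable_layerTwist s _ ρ x y) (integrable_layerTwist s _ σ x y)
  | h_std_basis a b c =>
    have hc : (single a b c : Op n) = c • single a b 1 := by simp
    have hbasis : entryMean (Measure.pi fun _ => haarGate)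
        (fun V => layerTwist s (tensorMap fun i => tau (j i)) V (single a b 1)) =
        ∑ ω : Fin (n / 2) → Bool, (∏ k, coinWeight (ω k)) •
          tensorMap (fun i => tau (merge hn s ω j i)) (single a b 1) := by
      ext x y
      simp only [entryMean_apply, layerTwist_tensorMap_single hn, pairTensor_apply]
      -- Independence of the gates turns the integral of the product into a product of single-gate
      -- twirls.
      rw [integral_fintype_prod_eq_prod (fun (k : Fin (n / 2)) (U : Gate) =>
        gateTwist (pairMap (tau (j (pairSite s k 0))) (tau (j (pairSite s k 1)))) (U : PairOp)
          (single (pairs s a k) (pairs s b k) 1) (pairs s x k) (pairs s y k))]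
      simp only [← entryMean_apply, ← gateTwirl_apply, gateTwirl_pairMap_tau]
      simp only [Matrix.sum_apply, Matrix.smul_apply, smul_eq_mul]
      rw [← sum_pi_prod]
      refine Finset.sum_congr rfl fun ω _ => ?_
      rw [single_eq_pairTensor hn s a b, tensorMap_pairTensor hn, pairTensor_apply,
        Finset.prod_mul_distrib, Complex.real_smul, Complex.ofReal_prod]
      simp only [merge_pairSite]
    rw [hc]
    simp only [map_smul, smul_comm _ c, ← Finset.smul_sum]
    rw [← hbasis]
    ext x y
    exact integral_const_mul c _

end layers

section circuit

open Matrix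

/-! ### The circuit as nested layers -/

/-- The nested product `B 0 * (B 1 * ⋯ * A 1) * A 0`. -/
def nestedProd {M : Type*} [Monoid M] : (h : ℕ) → (Fin h → M) → (Fin h → M) → M
  | 0, _, _ => 1
  | h + 1, A, B => B 0 * (nestedProd h (fun t => A t.succ) (fun t => B t.succ) * A 0)

lemma prod_reverse_ofFn_succ_succ {M : Type*} [Monoid M] {N : ℕ} (F : Fin (N + 1 + 1) → M) :
    (List.ofFn F).reverse.prod =
      F (Fin.last _) * ((List.ofFn fun t : Fin N => F t.succ.castSucc).reverse.prod * F 0) := by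
  rw [List.ofFn_succ', List.concat_eq_append, List.reverse_append, List.prod_append,
    List.ofFn_succ, List.reverse_cons, List.prod_append]
  simp

/-- Steps t and 2h - 1 - t share their gates; removing the first and the last step together exposes
the nesting. -/
lemma prod_reverse_ofFn_eq_nestedProd {M : Type*} [Monoid M] (h : ℕ) :
    ∀ A B : Fin h → M, (List.ofFn fun t : Fin (2 * h) =>
      if ht : (t : ℕ) < h then A ⟨t, ht⟩ else B ⟨2 * h - 1 - t, by omega⟩).reverse.prod =
        nestedProd h A B := by
  induction h with
  | zero => intro A B; rfl
  | succ h ih =>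
    intro A B
    refine (prod_reverse_ofFn_succ_succ (N := 2 * h) _).trans ?_
    rw [nestedProd, ← ih]
    congr 1
    · rw [dif_neg (by simp [Fin.last]; omega)]
      congr 1
      ext
      simp [Fin.last]
      omega
    · congr 1
      congr 3
      funext t
      have := t.2
      by_cases ht : (t : ℕ) < h
      · rw [dif_pos (by simpa using ht), dif_pos ht]
        rfl
      · rw [dif_neg (by simpa using ht), dif_neg ht]
        congr 1
        ext
        simp
        omega

variable {n : ℕ} [NeZero n]

/-- The noisy circuit built from the layers `s, …, s + h - 1` and their inverses. -/
def nestedCircuit (p : ℝ) : (s h : ℕ) → (Fin h → Fin (n / 2) → Gate) → Module.End ℂ (Op n)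
  | _, 0, _ => 1
  | s, h + 1, V => (noise n p ∘ₗ conjBy (brickLayer s (V 0))ᴴ) *
      (nestedCircuit p (s + 1) h (fun t => V t.succ) * (noise n p ∘ₗ conjBy (brickLayer s (V 0))))

lemma nestedProd_eq_nestedCircuit (p : ℝ) (h : ℕ) :
    ∀ (s : ℕ) (V : Fin h → Fin (n / 2) → Gate),
      nestedProd h (fun t => noise n p ∘ₗ conjBy (brickLayer (s + t) (V t)))
        (fun t => noise n p ∘ₗ conjBy (brickLayer (s + t) (V t))ᴴ) = nestedCircuit p s h V := by
  induction h with
  | zero => intro s V; rfl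
  | succ h ih =>
    intro s V
    rw [nestedProd, nestedCircuit, ← ih]
    simp only [Fin.val_succ, Fin.val_zero, add_zero, add_assoc, add_comm 1]

lemma noisyCircuit_eq_nestedCircuit (p : ℝ) {h : ℕ} (V : Fin h → Fin (n / 2) → Gate) :
    noisyCircuit p V = nestedCircuit p 0 h V := by
  rw [← nestedProd_eq_nestedCircuit, ← prod_reverse_ofFn_eq_nestedProd, noisyCircuit]
  congr 3
  funext t
  rw [noisyLayer]
  split_ifs
  · simp
  · simp

lemma continuous_nestedCircuit (p : ℝ) {X : Type*} [TopologicalSpace X] (h : ℕ) :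
    ∀ (s : ℕ) {V : X → Fin h → Fin (n / 2) → Gate} {ρ : X → Op n}, Continuous V → Continuous ρ →
      Continuous fun x => nestedCircuit p s h (V x) (ρ x) := by
  induction h with
  | zero => intro s V ρ _ hρ; exact hρ
  | succ h ih =>
    intro s V ρ hV hρ
    have hN : Continuous (noise n p) := LinearMap.continuous_of_finiteDimensional _
    have hB : Continuous fun x => (brickLayer s (V x 0) : Op n) :=
      (continuous_brickLayer s).comp ((continuous_apply 0).comp hV)
    have h1 : Continuous fun x => noise n p (conjBy (brickLayer s (V x 0)) (ρ x)) :=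
      hN.comp (continuous_conjBy hB hρ)
    have hV' : Continuous fun x => fun t : Fin h => V x t.succ :=
      continuous_pi fun t => (continuous_apply t.succ).comp hV
    have h2 := ih (s + 1) hV' h1
    have hB' : Continuous fun x => (brickLayer s (V x 0) : Op n)ᴴ := hB.matrix_conjTranspose
    have h3 := hN.comp (continuous_conjBy hB' h2)
    exact h3

/-- The law of the depolarized sites describes the circuit averaged over its gates. -/
theorem entryMean_nestedCircuit (hn : Even n) (p : ℝ) (h : ℕ) : ∀ (s : ℕ) (ρ : Op n),
    entryMean (Measure.pi fun _ : Fin h => Measure.pi fun _ : Fin (n / 2) => haarGate)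
        (fun V => nestedCircuit p s h V ρ) =
      ∑ j, circuitLaw hn p s h j • tensorMap (fun i => tau (j i)) ρ := by
  induction h with
  | zero =>
    intro s ρ
    have hid : tensorMap (fun i : ZMod n => tau ((0 : ZMod n → Fin 2) i)) ρ = ρ := by
      ext x y
      rw [tensorMap_apply, Fintype.sum_eq_single x, Fintype.sum_eq_single y]
      · simp [tau_zero_apply]
      · intro y' hy
        obtain ⟨i, hi⟩ := Function.ne_iff.1 hy
        rw [Finset.prod_eq_zero (Finset.mem_univ i) (by simp [tau_zero_apply, hi]), zero_mul]
      · intro x' hx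
        obtain ⟨i, hi⟩ := Function.ne_iff.1 hx
        refine Finset.sum_eq_zero fun y' _ => ?_
        rw [Finset.prod_eq_zero (Finset.mem_univ i) (by simp [tau_zero_apply, hi]), zero_mul]
    simp only [circuitLaw, Pi.single_apply, ite_smul, one_smul, zero_smul,
      Finset.sum_ite_eq', Finset.mem_univ, if_true, hid]
    ext x y
    simp [entryMean_apply, nestedCircuit]
  | succ h ih =>
    intro s ρ
    let μ : Measure (Fin (n / 2) → Gate) := Measure.pi fun _ => haarGate
    -- The law of the inner circuit together with the noise that precedes it, the noise following
    -- the outermost layer U.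
    let Q := flipPush p (circuitLaw hn p (s + 1) h)
    have hQ : ∀ σ : Op n, entryMean (Measure.pi fun _ : Fin h => μ)
        (fun V => nestedCircuit p (s + 1) h V (noise n p σ)) =
        ∑ j, Q j • tensorMap (fun i => tau (j i)) σ := by
      intro σ
      rw [ih]
      simp only [tensorMap_tau_noise]
      exact (sum_flipPush_smul p _ fun j => tensorMap (fun i => tau (j i)) σ).symm
    -- For fixed outermost gates W, averaging the inner gates leaves a mixture of twists by W.
    have hinner : ∀ W : Fin (n / 2) → Gate,
        entryMean (Measure.pi fun _ : Fin h => μ) (fun V => noise n p (conjBy (brickLayer s W)ᴴ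
          (nestedCircuit p (s + 1) h V (noise n p (conjBy (brickLayer s W) ρ))))) =
        noise n p (∑ j, Q j • layerTwist s (tensorMap fun i => tau (j i)) W ρ) := by
      intro W
      have hint : ∀ x y, Integrable (fun V : Fin h → Fin (n / 2) → Gate =>
          nestedCircuit p (s + 1) h V (noise n p (conjBy (brickLayer s W) ρ)) x y)
          (Measure.pi fun _ : Fin h => μ) := fun x y =>
        integrable_of_continuous
          ((continuous_nestedCircuit p h (s + 1) continuous_id continuous_const).matrix_elem x y)
      have := entryMean_linear (noise n p ∘ₗ conjBy (brickLayer s W)ᴴ) hint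
      simp only [LinearMap.comp_apply] at this
      rw [this, hQ]
      simp only [map_sum, LinearMap.map_smul_of_tower, layerTwist_apply]
    have hlayer : entryMean μ
        (fun W => ∑ j, Q j • layerTwist s (tensorMap fun i => tau (j i)) W ρ) =
        ∑ j, mergePush hn s Q j •
          tensorMap (fun i => tau (j i)) ρ := by
      rw [sum_mergePush_smul]
      simp only [← entryMean_layerTwist_tensorMap_tau hn s _ ρ]
      ext x y
      simp only [entryMean_apply, Matrix.sum_apply, Matrix.smul_apply]
      refine (integral_finsetSum _ fun j _ => (integrable_layerTwist s _ ρ x y).smul (Q j)).trans ?_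
      exact Finset.sum_congr rfl fun j _ =>
        integral_smul (Q j) fun V => layerTwist s (tensorMap fun i => tau (j i)) V ρ x y
    -- Fubini separates the outermost gates, index 0, from the inner ones.
    have hfub : ∀ x y, entryMean (Measure.pi fun _ : Fin (h + 1) => μ)
        (fun V => nestedCircuit p s (h + 1) V ρ) x y =
        ∫ W, entryMean (Measure.pi fun _ : Fin h => μ)
          (fun V => noise n p (conjBy (brickLayer s W)ᴴ
            (nestedCircuit p (s + 1) h V (noise n p (conjBy (brickLayer s W) ρ))))) x y ∂μ := by
      intro x y
      let G : (Fin (n / 2) → Gate) × (Fin h → Fin (n / 2) → Gate) → ℂ := fun q =>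
        nestedCircuit p s (h + 1) (Fin.cons q.1 q.2) ρ x y
      have hcons : Continuous fun q : (Fin (n / 2) → Gate) × (Fin h → Fin (n / 2) → Gate) =>
          (Fin.cons q.1 q.2 : Fin (h + 1) → Fin (n / 2) → Gate) :=
        continuous_pi fun t => by
          refine Fin.cases ?_ (fun t => ?_) t
          · exact continuous_fst
          · exact (continuous_apply t).comp continuous_snd
      have hG : Integrable G (μ.prod (Measure.pi fun _ : Fin h => μ)) :=
        integrable_of_continuous
          ((continuous_nestedCircuit p (h + 1) s hcons continuous_const).matrix_elem x y)
      have hmp := measurePreserving_piFinSuccAbove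
        (fun _ : Fin (h + 1) => μ) 0
      have h1 := hmp.integral_comp' (g := G)
      rw [integral_prod G hG] at h1
      have hV : ∀ V : Fin (h + 1) → Fin (n / 2) → Gate,
          G (MeasurableEquiv.piFinSuccAbove (fun _ => Fin (n / 2) → Gate) 0 V) =
            nestedCircuit p s (h + 1) V ρ x y := by
        intro V
        have : (Fin.cons (V 0) (fun t => V (Fin.succAbove 0 t)) :
            Fin (h + 1) → Fin (n / 2) → Gate) = V := by
          funext t
          refine Fin.cases rfl (fun t => ?_) t
          simp
        exact congrArg (fun V => nestedCircuit p s (h + 1) V ρ x y) this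
      simp only [hV] at h1
      exact h1
    have hL := entryMean_linear (μ := μ) (noise n p)
      (F := fun W => ∑ j, Q j • layerTwist s (tensorMap fun i => tau (j i)) W ρ) (by
        intro x y
        simp only [Matrix.sum_apply, Matrix.smul_apply]
        exact integrable_finsetSum _ fun j _ => (integrable_layerTwist s _ ρ x y).smul (Q j))
    have hmain : entryMean (Measure.pi fun _ : Fin (h + 1) => μ)
        (fun V => nestedCircuit p s (h + 1) V ρ) =
        entryMean μ (fun W => noise n p
          (∑ j, Q j • layerTwist s (tensorMap fun i => tau (j i)) W ρ)) := by
      ext x y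
      rw [hfub]
      simp only [hinner]
      rfl
    rw [hmain, hL, hlayer]
    simp only [map_sum, LinearMap.map_smul_of_tower, noise_tensorMap_tau, circuitLaw]
    exact (sum_flipPush_smul p _ fun j => tensorMap (fun i => tau (j i)) ρ).symm

/-! ### Uniqueness of the law -/

/-- One matrix entry isolates P(j₀). Where j₀ is 0, input |0⟩⟨1| and entry (0,1) are seen by τ₀ but
killed by τ₁; where j₀ is 1, input |1⟩⟨1| and entry (0,0) are seen only by τ₁. -/
lemma isDepolarizationLaw_unique {Φ : Op n → Op n} {P P' : (ZMod n → Fin 2) → ℝ}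
    (hP : IsDepolarizationLaw Φ P) (hP' : IsDepolarizationLaw Φ P') : P' = P := by
  funext j₀
  have hτ : ∀ a b : Fin 2, tau b (single a 1 1) 0 (1 - a) =
      if b = a then (if a = 0 then 1 else 1 / 2) else 0 := by
    intro a b
    fin_cases a <;> fin_cases b <;> simp [tau_zero_apply, tau_one_apply]
  have hcoef : ∀ j : ZMod n → Fin 2,
      tensorMap (fun i => tau (j i)) (single j₀ 1 1) 0 (fun i => 1 - j₀ i) =
      if j = j₀ then ∏ i, (if j₀ i = 0 then 1 else 1 / 2) else 0 := by
    intro j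
    rw [tensorMap_apply, Fintype.sum_eq_single j₀, Fintype.sum_eq_single 1]
    · simp only [single_apply_same, mul_one, Pi.one_apply, Pi.zero_apply, hτ]
      split_ifs with h
      · subst h; simp
      · obtain ⟨i, hi⟩ := Function.ne_iff.1 h
        exact Finset.prod_eq_zero (Finset.mem_univ i) (if_neg hi)
    · intro y hy; simp [hy.symm]
    · intro x hx; simp [hx.symm]
  have hval : ∀ {R : (ZMod n → Fin 2) → ℝ}, IsDepolarizationLaw Φ R →
      Φ (single j₀ 1 1) 0 (fun i => 1 - j₀ i) =
        (R j₀ : ℂ) * ∏ i, (if j₀ i = 0 then 1 else 1 / 2) := by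
    intro R hR
    rw [hR.map_eq]
    simp only [Matrix.sum_apply, Matrix.smul_apply, hcoef, smul_eq_mul]
    simp
  have h := (hval hP').symm.trans (hval hP)
  have hne : (∏ i, (if j₀ i = 0 then (1 : ℂ) else 1 / 2)) ≠ 0 :=
    Finset.prod_ne_zero_iff.2 fun i _ => by split_ifs <;> norm_num
  exact_mod_cast mul_right_cancel₀ hne h

/-! ### The averaged circuit and its mean number of depolarized qubits -/

lemma isDepolarizationLaw_circuitLaw (hn : Even n) (D : ℕ) {p : ℝ} (h0 : 0 ≤ p) (h1 : p ≤ 1) :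
    IsDepolarizationLaw (averagedChannel n D p) (circuitLaw hn p 0 (D / 2)) where
  nonneg := circuitLaw_nonneg hn h0 h1 _ 0
  sum_eq_one := sum_circuitLaw hn p _ 0
  map_eq ρ := by
    have h := entryMean_nestedCircuit hn p (D / 2) 0 ρ
    simp only [← noisyCircuit_eq_nestedCircuit] at h
    simp only [Complex.coe_smul]
    exact h

lemma expectedDepolarized_circuitLaw (hn : Even n) (p : ℝ) (h : ℕ) :
    expectedDepolarized (circuitLaw hn p 0 h) = ∑ i, evolve hn p (occupied i) h 0 := by
  have hcard : ∀ j : ZMod n → Fin 2,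
      ((Finset.univ.filter fun i => j i = 1).card : ℝ) = ∑ i, occupied i j := by
    intro j
    simp [occupied]
  simp only [expectedDepolarized, hcard, Finset.mul_sum]
  rw [Finset.sum_comm]
  refine Finset.sum_congr rfl fun i _ => ?_
  have := sum_circuitLaw_mul hn p (occupied i) h 0
  rw [zero_add] at this
  exact this

end circuit

end NoisyCircuit

end

theorem proposition3 :
    ∀ c : ℝ, 0 < c → c < 3 / 4 →
      ∃ κ : ℝ, 0 < κ ∧
        ∀ (n : ℕ) [NeZero n] (D : ℕ) (p : ℝ),
          Even n → Even D → D < n → 0 ≤ p → p ≤ 1 →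
          ∃ P : (ZMod n → Fin 2) → ℝ,
            NoisyCircuit.IsDepolarizationLaw (NoisyCircuit.averagedChannel n D p) P ∧
            (∀ P' : (ZMod n → Fin 2) → ℝ,
              NoisyCircuit.IsDepolarizationLaw (NoisyCircuit.averagedChannel n D p) P' →
                P' = P) ∧
            c * (1 - (1 - p) ^ (κ * (D : ℝ) ^ 2)) ≤
              NoisyCircuit.expectedDepolarized P / (n : ℝ) := by
  intro c hc hc'
  have hlim : Filter.Tendsto (fun q : ℕ => (512 / 625 : ℝ) ^ q) Filter.atTop (nhds 0) :=
    tendsto_pow_atTop_nhds_zero_of_lt_one (by norm_num) (by norm_num)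
  -- The factor 5/8 cancels the 8/5 of the growth estimate, so from `N` on its error is below 3/4 -
  -- c.
  obtain ⟨N, hN⟩ := Filter.eventually_atTop.1
    (hlim.eventually_lt_const (show (0 : ℝ) < 5 / 8 * (3 / 4 - c) by linarith))
  have hcq : ∀ q, N + 1 ≤ q → c ≤ 3 / 4 - 8 / 5 * (512 / 625 : ℝ) ^ q := fun q hq => by
    have := hN q (by omega)
    linarith
  refine ⟨1 / (1024 * ((N + 1 : ℕ) : ℝ) ^ 2), by positivity, ?_⟩
  intro n _ D p hn hD hDn h0 h1
  have hlaw := NoisyCircuit.isDepolarizationLaw_circuitLaw hn D h0 h1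
  refine ⟨_, hlaw, fun P' hP' => NoisyCircuit.isDepolarizationLaw_unique hlaw hP', ?_⟩
  have hDh := Nat.two_mul_div_two_of_even hD
  have hnpos : (0 : ℝ) < n := by exact_mod_cast NeZero.pos n
  rw [NoisyCircuit.expectedDepolarized_circuitLaw, le_div_iff₀ hnpos]
  have hD2 : (D : ℝ) = 2 * ((D / 2 : ℕ) : ℝ) := by exact_mod_cast hDh.symm
  rw [hD2]
  have hsum := Finset.sum_le_sum fun (i : ZMod n) (_ : i ∈ Finset.univ) =>
    NoisyCircuit.le_evolve_occupied_zero hc (Nat.succ_pos N) hcq hn h0 h1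
      (h := D / 2) (by omega) i
  rw [Finset.sum_const, Finset.card_univ, ZMod.card, nsmul_eq_mul, mul_comm] at hsum
  exact hsum
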